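/- Let $J$ be an ideal on $\omega$, that is, a family of subsets of $\omega$ which is closed under subsets and finite unions, contains all finite subsets of $\omega$, and does not contain $\omega$. Let ${}^\omega 2$ be the Cantor space with its product topology, and let $\mu$ be the completion of the product of the uniform probability measures on $\{0,1\}$. Let $\mathcal{N}$ be the ideal of $\mu$-null subsets of ${}^\omega 2$, $\mathcal{M}$ the ideal of meager subsets of ${}^\omega 2$, and $\mathcal{E}$ the $\sigma$-ideal generated by the closed $\mu$-null subsets of ${}^\omega 2$. Let $\overline{\Omega}$ be the set of all sequences $\bar c=\langle c_n : n<\omega\rangle$ of clopen subsets of ${}^\omega 2$ for which $\{x\in{}^\omega 2 : x\in c_n\text{ for infinitely many }n\}$ is $\mu$-null. Let $\mathcal{N}_J$ be the family of all $X\subseteq{}^\omega 2$ for which there is $\bar c\in\overline{\Omega}$ with $\{n : x\in c_n\}\notin J$ for all $x\in X$, and let $\mathcal{N}^*_J$ be the family of all $X\subseteq{}^\omega 2$ for which there is $\bar c\in\overline{\Omega}$ with $\{n : x\notin c_n\}\in J$ for all $x\in X$. For each of these families $\mathcal{I}$ of subsets of ${}^\omega 2$, let $\mathrm{add}(\mathcal{I})$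 be the least size of a subfamily of $\mathcal{I}$ with no $\subseteq$-upper bound in $\mathcal{I}$, $\mathrm{cov}(\mathcal{I})$ the least size of a subfamily of $\mathcal{I}$ whose union is ${}^\omega 2$, $\mathrm{non}(\mathcal{I})$ the least size of a subset of ${}^\omega 2$ that is not contained in any member of $\mathcal{I}$, and $\mathrm{cof}(\mathcal{I})$ the least size of a $\subseteq$-cofinal subfamily of $\mathcal{I}$. Say that $s\subseteq\omega$ splits $a\subseteq\omega$ if $a\cap s$ and $a\smallsetminus s$ are both infinite. The splitting number $\mathfrak{s}$ is the least size of a family $S$ of infinite subsets of $\omega$ such that every infinite subset of $\omega$ is split by some member of $S$; the reaping number $\mathfrak{r}$ is the least size of a family $R$ of infinite subsets of $\omega$ such that no single subset of $\omega$ splits all members of $R$. Then: (a) $\mathrm{cov}(\mathcal{N})\leq\mathrm{cov}(\mathcal{N}_J)\leq\mathrm{cov}(\mathcal{N}^*_J)\leq\mathrm{cov}(\mathcal{E})\leq\min\{\mathrm{cof}(\mathcal{M}),\mathfrak{r}\}$ and $\max\{\mathrm{add}(\mathcal{M}),\mathfrak{s}\}\leq\mathrm{non}(\mathcal{E})\leq\mathrm{non}(\mathcal{N}^*_J)\leq\mathrm{non}(\mathcal{N}_J)\leq\mathrm{non}(\mathcal{N})$.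 (b) $\mathrm{add}(\mathcal{N})\leq\mathrm{add}(\mathcal{N}_J)\leq\mathrm{cov}(\mathcal{M})$, $\mathrm{add}(\mathcal{N})\leq\mathrm{add}(\mathcal{N}^*_J)\leq\mathrm{cov}(\mathcal{M})$, $\mathrm{non}(\mathcal{M})\leq\mathrm{cof}(\mathcal{N}_J)\leq\mathrm{cof}(\mathcal{N})$ and $\mathrm{non}(\mathcal{M})\leq\mathrm{cof}(\mathcal{N}^*_J)\leq\mathrm{cof}(\mathcal{N})$. -/

import Mathlib

open MeasureTheory TopologicalSpace

namespace NullModIdeal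

noncomputable section

/-- An ideal on a set `M`: a hereditary family of subsets of `M`, closed under finite unions,
containing all finite subsets of `M`, and not containing `M` itself. -/
structure IsIdealOn {M : Type} (J : Set (Set M)) : Prop where
  mem_of_subset : ∀ ⦃a b : Set M⦄, a ⊆ b → b ∈ J → a ∈ J
  union_mem : ∀ ⦃a b : Set M⦄, a ∈ J → b ∈ J → a ∪ b ∈ J
  finite_mem : ∀ ⦃a : Set M⦄, a.Finite → a ∈ J
  univ_notMem : Set.univ ∉ J

/-! ### The Cantor space, its measure, and the classical ideals -/

/-- The Cantor space, with the product topology and the product σ-algebra. -/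
abbrev Cantor : Type := ℕ → Bool

/-- The fair-coin product probability measure on the Cantor space. As a Mathlib measure it is
applied to arbitrary sets through its outer measure, so `cantorMeasure A = 0` says exactly that
`A` has measure zero for the completed measure. -/
def cantorMeasure : Measure Cantor :=
  Measure.infinitePi fun _ : ℕ => (PMF.uniformOfFintype Bool).toMeasure

/-- The ideal of measure zero sets. -/
def nullIdeal : Set (Set Cantor) := {X | cantorMeasure X = 0}

/-- The ideal of meager sets. -/
def meagerIdeal : Set (Set Cantor) := {X | IsMeagre X}

/-- The σ-ideal generated by the closed measure zero sets. -/
def closedNullIdeal : Set (Set Cantor) :=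
  {X | ∃ F : ℕ → Set Cantor,
    (∀ n, IsClosed (F n) ∧ cantorMeasure (F n) = 0) ∧ X ⊆ ⋃ n, F n}

/-! ### Measure zero modulo an ideal on the natural numbers -/

/-- `N(c)`: the points that belong to infinitely many `c n`. -/
def limsupSet (c : ℕ → Clopens Cantor) : Set Cantor := {x | {n | x ∈ c n}.Infinite}

/-- Sequences of clopen sets such that `N(c)` has measure zero. -/
def OmegaBar : Set (ℕ → Clopens Cantor) := {c | limsupSet c ∈ nullIdeal}

/-- `N_J(c)`: the points `x` for which `{n | x ∈ c n}` is `J`-positive. -/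
def posSet (J : Set (Set ℕ)) (c : ℕ → Clopens Cantor) : Set Cantor :=
  {x | {n | x ∈ c n} ∉ J}

/-- `N*_J(c)`: the points `x` for which `{n | x ∈ c n}` is in the dual filter of `J`. -/
def dualSet (J : Set (Set ℕ)) (c : ℕ → Clopens Cantor) : Set Cantor :=
  {x | {n | x ∈ c n}ᶜ ∈ J}

/-- The family `N_J` of the sets that have measure zero modulo `J`. -/
def nullMod (J : Set (Set ℕ)) : Set (Set Cantor) := {X | ∃ c ∈ OmegaBar, X ⊆ posSet J c}

/-- The family `N*_J`. -/
def nullModStar (J : Set (Set ℕ)) : Set (Set Cantor) := {X | ∃ c ∈ OmegaBar, X ⊆ dualSet J c}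

/-! ### Cardinal characteristics -/

/-- The least size of an unbounded set in the relational system `⟨X, Y, R⟩`. -/
def bNum {α β : Type} (X : Set α) (Y : Set β) (R : α → β → Prop) : Cardinal.{0} :=
  sInf {κ | ∃ F : Set α, F ⊆ X ∧ (¬ ∃ y ∈ Y, ∀ x ∈ F, R x y) ∧ Cardinal.mk F = κ}

/-- The least size of a dominating set in the relational system `⟨X, Y, R⟩`. -/
def dNum {α β : Type} (X : Set α) (Y : Set β) (R : α → β → Prop) : Cardinal.{0} :=
  sInf {κ | ∃ D : Set β, D ⊆ Y ∧ (∀ x ∈ X, ∃ y ∈ D, R x y) ∧ Cardinal.mk D = κ}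

/-- The additivity of an ideal: the least size of a subfamily with no upper bound in it. -/
def addNum {α : Type} (I : Set (Set α)) : Cardinal.{0} := bNum I I fun A B => A ⊆ B

/-- The cofinality of an ideal: the least size of a cofinal subfamily. -/
def cofNum {α : Type} (I : Set (Set α)) : Cardinal.{0} := dNum I I fun A B => A ⊆ B

/-- The uniformity of an ideal: the least size of a set that no member of it covers. -/
def nonNum {α : Type} (I : Set (Set α)) : Cardinal.{0} :=
  bNum (Set.univ : Set α) I fun x A => x ∈ A

/-- The covering of an ideal: the least size of a subfamily that covers the whole space. -/
def covNum {α : Type} (I : Set (Set α)) : Cardinal.{0} :=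
  dNum (Set.univ : Set α) I fun x A => x ∈ A

/-- `s` splits `a`: both `a ∩ s` and `a \ s` are infinite. -/
def Splits (s a : Set ℕ) : Prop := (a ∩ s).Infinite ∧ (a \ s).Infinite

/-- The splitting number: the least size of a family of infinite subsets of `ℕ` such that every
infinite subset of `ℕ` is split by a member of the family. -/
def splittingNumber : Cardinal.{0} :=
  sInf {κ | ∃ S : Set (Set ℕ), (∀ s ∈ S, s.Infinite) ∧
    (∀ a : Set ℕ, a.Infinite → ∃ s ∈ S, Splits s a) ∧ Cardinal.mk S = κ}

/-- The reaping number: the least size of a family of infinite subsets of `ℕ` such that no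
single subset of `ℕ` splits all the members of the family. -/
def reapingNumber : Cardinal.{0} :=
  sInf {κ | ∃ R : Set (Set ℕ), (∀ a ∈ R, a.Infinite) ∧
    (¬ ∃ s : Set ℕ, ∀ a ∈ R, Splits s a) ∧ Cardinal.mk R = κ}

end

end NullModIdeal

open Filter

namespace NullModIdeal

/-! ### Relational systems and Tukey connections -/

section Cardinals

variable {α β α' β' : Type} {X : Set α} {Y : Set β} {R : α → β → Prop}
  {X' : Set α'} {Y' : Set β'} {R' : α' → β' → Prop}

/-! The comparisons of cov and non among E, N*_J, N_J and N follow from E ⊆ N*_J ⊆ N_J ⊆ N. The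
other inequalities come from Tukey-type connections, each giving a bound and its dual.

For cof(M) and add(M), a point x is sent to the meager set of points differing from x on almost all
intervals [k², (k+1)²); a meager superset yields a set in E containing x
(`tukeyLE_closedNull_meager`). For r and s, the points not splitting a given infinite set form a
member of E.

For add(N) and cof(N), Bartoszyński's localization of functions by slaloms in terms of null sets
(`exists_localization`) is applied to codes of finite pieces of a sequence of clopen sets. It makes
eventual inclusion on sequences with null limsup Tukey below inclusion of null sets
(`exists_omegaBar_tukey`), and both N_J(c) and N*_J(c) are monotone for eventual inclusion.

For cov(M) and non(M), any family between E and N works. A function x is sent to a set in E each of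
whose null supersets yields a slalom of fixed width capturing x infinitely often
(`exists_antiLocalization`). Doing this twice defeats a meager set given as a chopped real (a, z):
one slalom gives a partition with infinitely many blocks containing a block of a, the next guesses z
on many such blocks at once, and a system of distinct representatives merges the guesses into a
point outside the meager set (`exists_two_step_connection`). -/

theorem bNum_le_mk {F : Set α} (hF : F ⊆ X) (h : ¬ ∃ y ∈ Y, ∀ x ∈ F, R x y) :
    bNum X Y R ≤ Cardinal.mk F :=
  csInf_le' ⟨F, hF, h, rfl⟩

theorem dNum_le_mk {D : Set β} (hD : D ⊆ Y) (h : ∀ x ∈ X, ∃ y ∈ D, R x y) :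
    dNum X Y R ≤ Cardinal.mk D :=
  csInf_le' ⟨D, hD, h, rfl⟩

/-- The hypothesis makes the infimum range over a nonempty set, so that it is attained; an empty
infimum of cardinals is 0. -/
theorem exists_mk_eq_bNum (h : ¬ ∃ y ∈ Y, ∀ x ∈ X, R x y) :
    ∃ F ⊆ X, (¬ ∃ y ∈ Y, ∀ x ∈ F, R x y) ∧ Cardinal.mk F = bNum X Y R := by
  obtain ⟨F, h1, h2, h3⟩ := csInf_mem (s := {κ | ∃ F : Set α, F ⊆ X ∧
    (¬ ∃ y ∈ Y, ∀ x ∈ F, R x y) ∧ Cardinal.mk F = κ}) ⟨_, X, subset_rfl, h, rfl⟩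
  exact ⟨F, h1, h2, h3⟩

theorem exists_mk_eq_dNum (h : ∀ x ∈ X, ∃ y ∈ Y, R x y) :
    ∃ D ⊆ Y, (∀ x ∈ X, ∃ y ∈ D, R x y) ∧ Cardinal.mk D = dNum X Y R := by
  obtain ⟨F, h1, h2, h3⟩ := csInf_mem (s := {κ | ∃ D : Set β, D ⊆ Y ∧
    (∀ x ∈ X, ∃ y ∈ D, R x y) ∧ Cardinal.mk D = κ}) ⟨_, Y, subset_rfl, h, rfl⟩
  exact ⟨F, h1, h2, h3⟩

/-- A Tukey connection between two relational systems, read as `⟨X, Y, R⟩ ≤ ⟨X', Y', R'⟩`. -/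
def TukeyLE (X : Set α) (Y : Set β) (R : α → β → Prop)
    (X' : Set α') (Y' : Set β') (R' : α' → β' → Prop) : Prop :=
  ∃ (φ : α → α') (ψ : β' → β), (∀ x ∈ X, φ x ∈ X') ∧ (∀ y ∈ Y', ψ y ∈ Y) ∧
    ∀ x ∈ X, ∀ y ∈ Y', R' (φ x) y → R x (ψ y)

theorem TukeyLE.bNum_le (h : TukeyLE X Y R X' Y' R') (hb : ¬ ∃ y ∈ Y, ∀ x ∈ X, R x y) :
    bNum X' Y' R' ≤ bNum X Y R := by
  obtain ⟨φ, ψ, hφ, hψ, h⟩ := h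
  obtain ⟨F, hF, hF', hc⟩ := exists_mk_eq_bNum hb
  rw [← hc]
  refine (bNum_le_mk (F := φ '' F) ?_ ?_).trans Cardinal.mk_image_le
  · rintro _ ⟨x, hx, rfl⟩
    exact hφ x (hF hx)
  · rintro ⟨y, hy, hy'⟩
    exact hF' ⟨ψ y, hψ y hy, fun x hx => h x (hF hx) y hy (hy' _ ⟨x, hx, rfl⟩)⟩

theorem TukeyLE.dNum_le (h : TukeyLE X Y R X' Y' R') (hd : ∀ x ∈ X', ∃ y ∈ Y', R' x y) :
    dNum X Y R ≤ dNum X' Y' R' := by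
  obtain ⟨φ, ψ, hφ, hψ, h⟩ := h
  obtain ⟨D, hD, hD', hc⟩ := exists_mk_eq_dNum hd
  rw [← hc]
  refine (dNum_le_mk (D := ψ '' D) ?_ ?_).trans Cardinal.mk_image_le
  · rintro _ ⟨y, hy, rfl⟩
    exact hψ y (hD hy)
  · intro x hx
    obtain ⟨y, hy, hxy⟩ := hD' _ (hφ x hx)
    exact ⟨_, ⟨y, hy, rfl⟩, h x hx y (hD hy) hxy⟩

/-- A proper family containing all singletons has an unbounded subfamily. -/
theorem not_exists_upper_bound {I : Set (Set α)} (h1 : ∀ x, {x} ∈ I) (h2 : Set.univ ∉ I) :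
    ¬ ∃ B ∈ I, ∀ A ∈ I, A ⊆ B := by
  rintro ⟨B, hB, h⟩
  have : B = Set.univ := Set.eq_univ_of_forall fun x => h _ (h1 x) rfl
  exact h2 (this ▸ hB)

theorem covNum_anti {I I' : Set (Set α)} (h : I ⊆ I') (h1 : ∀ x, {x} ∈ I) :
    covNum I' ≤ covNum I :=
  TukeyLE.dNum_le ⟨id, id, fun _ h => h, fun _ hy => h hy, fun _ _ _ _ h => h⟩
    fun x _ => ⟨{x}, h1 x, rfl⟩

theorem nonNum_mono {I I' : Set (Set α)} (h : I ⊆ I') (h1 : Set.univ ∉ I') :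
    nonNum I ≤ nonNum I' :=
  TukeyLE.bNum_le ⟨id, id, fun _ h => h, fun _ hy => h hy, fun _ _ _ _ h => h⟩ <| by
    rintro ⟨A, hA, h⟩
    exact h1 (Set.eq_univ_of_forall (fun x => h x trivial) ▸ hA)

end Cardinals

end NullModIdeal

namespace NullModIdeal

/-! ### Cylinders, measure and branches in the Cantor space -/

section CantorMeasure

instance : IsProbabilityMeasure cantorMeasure := by
  unfold cantorMeasure
  infer_instance

/-- The points that agree with `z` at all elements of `s`. -/
def agreeSet (s : Finset ℕ) (z : Cantor) : Set Cantor := {y | ∀ i ∈ s, y i = z i}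

theorem isClopen_coord (i : ℕ) (b : Bool) : IsClopen {y : Cantor | y i = b} :=
  (isClopen_discrete {b}).preimage (continuous_apply i)

theorem isClopen_agreeSet (s : Finset ℕ) (z : Cantor) : IsClopen (agreeSet s z) := by
  have : agreeSet s z = ⋂ i ∈ s, {y : Cantor | y i = z i} := by
    ext y
    simp [agreeSet]
  rw [this]
  exact isClopen_biInter_finset fun i _ => isClopen_coord i _

theorem measure_agreeSet (s : Finset ℕ) (z : Cantor) :
    cantorMeasure (agreeSet s z) = 2⁻¹ ^ s.card := by
  have : agreeSet s z = Set.pi s fun i => {z i} := by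
    ext y
    simp [agreeSet, Set.mem_pi]
  rw [this, cantorMeasure, Measure.infinitePi_pi _ fun i _ => measurableSet_singleton _]
  simp

/-- The basic clopen set of the points that agree with `z` below `n`. -/
def initSet (n : ℕ) (z : Cantor) : Set Cantor := {y | ∀ i < n, y i = z i}

theorem initSet_eq (n : ℕ) (z : Cantor) : initSet n z = agreeSet (Finset.range n) z := by
  simp [initSet, agreeSet]

theorem isClopen_initSet (n : ℕ) (z : Cantor) : IsClopen (initSet n z) :=
  initSet_eq n z ▸ isClopen_agreeSet _ _

theorem mem_initSet_self (n : ℕ) (z : Cantor) : z ∈ initSet n z := fun _ _ => rfl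

theorem initSet_congr {n : ℕ} {z w : Cantor} (h : z ∈ initSet n w) : initSet n z = initSet n w := by
  ext y
  exact forall₂_congr fun i hi => by rw [h i hi]

theorem exists_initSet_subset {U : Set Cantor} (hU : IsOpen U) {y : Cantor} (hy : y ∈ U) :
    ∃ n, initSet n y ⊆ U := by
  obtain ⟨I, u, hu, hs⟩ := isOpen_pi_iff.1 hU y hy
  refine ⟨I.sup id + 1, fun w hw => hs fun i hi => ?_⟩
  rw [hw i (Nat.lt_succ_of_le (Finset.le_sup (f := id) hi))]
  exact (hu i hi).2

/-- The point whose support is the finite set `u`. -/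
def ofFinset (u : Finset ℕ) : Cantor := fun i => decide (i ∈ u)

theorem exists_mem_initSet_ofFinset (n : ℕ) (y : Cantor) :
    ∃ u ∈ (Finset.range n).powerset, y ∈ initSet n (ofFinset u) := by
  refine ⟨(Finset.range n).filter fun i => y i = true, by simp, fun i hi => ?_⟩
  simp [ofFinset, hi]

theorem measure_eq_zero_of_le_pow {A : Set Cantor} (h : ∀ n : ℕ, cantorMeasure A ≤ 2⁻¹ ^ n) :
    cantorMeasure A = 0 := by
  refine le_antisymm (ge_of_tendsto' (ENNReal.tendsto_pow_atTop_nhds_zero_of_lt_one ?_) h) zero_le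
  exact ENNReal.inv_lt_one.2 (by norm_num)

/-- Some basic clopen set of level `n` carries at least the average share of the measure of `A`. -/
theorem exists_le_measure_inter_initSet (n : ℕ) {A : Set Cantor} (hA : A.Nonempty) :
    ∃ y ∈ A, cantorMeasure A ≤ 2 ^ n * cantorMeasure (A ∩ initSet n y) := by
  induction n with
  | zero =>
    obtain ⟨y, hy⟩ := hA
    exact ⟨y, hy, by simp [initSet]⟩
  | succ n ih =>
    obtain ⟨y, hy, h⟩ := ih
    obtain ⟨b, hb⟩ : ∃ b, cantorMeasure (A ∩ initSet n y) ≤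
        2 * cantorMeasure (A ∩ initSet n y ∩ {w | w n = b}) := by
      have hle : cantorMeasure (A ∩ initSet n y) ≤
          cantorMeasure (A ∩ initSet n y ∩ {w | w n = true}) +
          cantorMeasure (A ∩ initSet n y ∩ {w | w n = false}) := by
        refine (measure_mono fun w hw => ?_).trans (measure_union_le _ _)
        cases hwn : w n
        · exact Or.inr ⟨hw, hwn⟩
        · exact Or.inl ⟨hw, hwn⟩
      rcases le_total (cantorMeasure (A ∩ initSet n y ∩ {w | w n = true}))
        (cantorMeasure (A ∩ initSet n y ∩ {w | w n = false})) with h' | h'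
      · exact ⟨false, hle.trans (by rw [two_mul]; gcongr)⟩
      · exact ⟨true, hle.trans (by rw [two_mul]; gcongr)⟩
    -- The witness must lie in `A`. If the heavier half is empty then `A` is null and the old
    -- witness serves.
    rcases (A ∩ initSet n y ∩ {w | w n = b}).eq_empty_or_nonempty with he | ⟨w, hw⟩
    · refine ⟨y, hy, ?_⟩
      rw [he, measure_empty, mul_zero] at hb
      rw [nonpos_iff_eq_zero.1 hb, mul_zero] at h
      exact h.trans zero_le
    · refine ⟨w, hw.1.1, h.trans ?_⟩
      rw [pow_succ, mul_assoc]
      gcongr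
      refine hb.trans (mul_le_mul' le_rfl (measure_mono fun v hv => ⟨hv.1.1, fun i hi => ?_⟩))
      rcases Nat.lt_succ_iff_lt_or_eq.1 hi with hi | rfl
      · rw [hv.1.2 i hi, hw.1.2 i hi]
      · exact (show v i = b from hv.2).trans (show w i = b from hw.2).symm

/-- A branch through a closed set, built by successive extension of initial segments. -/
theorem exists_branch {K : Set Cantor} (hK : IsClosed K) {good : ℕ → ℕ → Cantor → Prop}
    {n₀ : ℕ} {z₀ : Cantor} (h0 : good 0 n₀ z₀)
    (hstep : ∀ i n z, good i n z → ∃ n' > n, ∃ z' ∈ initSet n z, good (i + 1) n' z')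
    (hmem : ∀ i n z, good i n z → (K ∩ initSet n z).Nonempty) :
    ∃ y ∈ K, ∀ i, ∃ n z, good i n z ∧ y ∈ initSet n z := by
  choose! N hN Z hZ hg using hstep
  let st : ℕ → ℕ × Cantor := fun i =>
    Nat.rec (n₀, z₀) (fun i p => (N i p.1 p.2, Z i p.1 p.2)) i
  have hst : ∀ i, good i (st i).1 (st i).2 := by
    intro i
    induction i with
    | zero => exact h0
    | succ i ih => exact hg i _ _ ih
  have hlt : ∀ i, (st i).1 < (st (i + 1)).1 := fun i => hN i _ _ (hst i)
  have hmono : StrictMono fun i => (st i).1 := strictMono_nat_of_lt_succ hlt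
  have hag : ∀ i j, i ≤ j → (st j).2 ∈ initSet (st i).1 (st i).2 := by
    intro i j hij
    induction j, hij using Nat.le_induction with
    | base => exact mem_initSet_self _ _
    | succ j hij ih =>
      intro k hk
      rw [← ih k hk]
      exact hZ j _ _ (hst j) k (hk.trans_le (hmono.monotone hij))
  choose w hwK hw using fun i => hmem i _ _ (hst i)
  -- Levels grow strictly, so coordinate k is settled after k + 1 steps.
  let y : Cantor := fun k => (st (k + 1)).2 k
  have hy : ∀ i, y ∈ initSet (st i).1 (st i).2 := by
    intro i k hk
    rcases le_total (k + 1) i with h | h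
    · exact (hag _ _ h k ((hmono.le_apply (x := k + 1)).trans_lt' (Nat.lt_succ_self k))).symm
    · exact hag _ _ h k hk
  refine ⟨y, hK.mem_of_tendsto (b := atTop) (f := w) ?_ (Eventually.of_forall hwK),
    fun i => ⟨_, _, hst i, hy i⟩⟩
  refine tendsto_pi_nhds.2 fun k => tendsto_const_nhds.congr' ?_
  filter_upwards [eventually_gt_atTop k] with i hi
  have hk : k < (st i).1 := hi.trans_le (hmono.le_apply (x := i))
  rw [hw i k hk, hy i k hk]

theorem exists_isClosed_disjoint_of_null {B : Set Cantor} (hB : cantorMeasure B = 0) :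
    ∃ K : Set Cantor, IsClosed K ∧ Disjoint K B ∧ 2⁻¹ ≤ cantorMeasure K := by
  obtain ⟨V, hBV, hV, hlt⟩ := B.exists_isOpen_lt_of_lt (μ := cantorMeasure) 2⁻¹
    (by rw [hB]; simp)
  refine ⟨Vᶜ, hV.isClosed_compl, Set.disjoint_left.2 fun x hx hxB => hx (hBV hxB), ?_⟩
  rw [prob_compl_eq_one_sub hV.measurableSet]
  refine ENNReal.le_sub_of_add_le_left (by finiteness) ?_
  refine (add_le_add_left hlt.le _).trans ?_
  rw [ENNReal.inv_two_add_inv_two]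

end CantorMeasure

/-! ### The inclusions between the four families -/

section Families

theorem measure_agree_infinite {P : Set ℕ} (hP : P.Infinite) (z : Cantor) :
    cantorMeasure {y | ∀ i ∈ P, y i = z i} = 0 := by
  refine measure_eq_zero_of_le_pow fun n => ?_
  obtain ⟨s, hs, rfl⟩ := hP.exists_subset_card_eq n
  rw [← measure_agreeSet s z]
  exact measure_mono fun y hy i hi => hy i (hs hi)

theorem isClosed_agree (P : Set ℕ) (z : Cantor) : IsClosed {y : Cantor | ∀ i ∈ P, y i = z i} := by
  have : {y : Cantor | ∀ i ∈ P, y i = z i} = ⋂ i ∈ P, {y : Cantor | y i = z i} := by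
    ext y
    simp
  rw [this]
  exact isClosed_biInter fun i _ => (isClopen_coord i _).1

theorem singleton_mem_closedNullIdeal (x : Cantor) : {x} ∈ closedNullIdeal := by
  refine ⟨fun _ => {y | ∀ i ∈ Set.univ, y i = x i}, fun _ => ⟨isClosed_agree _ _,
    measure_agree_infinite Set.infinite_univ _⟩, ?_⟩
  rintro _ rfl
  simp

theorem univ_notMem_nullIdeal : Set.univ ∉ nullIdeal := by
  simp [nullIdeal]

variable {J : Set (Set ℕ)}

theorem nullModStar_subset_nullMod (hJ : IsIdealOn J) : nullModStar J ⊆ nullMod J := by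
  rintro X ⟨c, hc, hX⟩
  refine ⟨c, hc, fun x hx h => hJ.univ_notMem ?_⟩
  rw [← Set.union_compl_self {n | x ∈ c n}]
  exact hJ.union_mem h (hX hx)

theorem nullMod_subset_nullIdeal (hJ : IsIdealOn J) : nullMod J ⊆ nullIdeal := by
  rintro X ⟨c, hc, hX⟩
  exact measure_mono_null (fun x hx => fun h => hX hx (hJ.finite_mem h)) hc

theorem measure_frequently_eq_zero {A : ℕ → Set Cantor} {m : ℕ → ℕ} (hm : ∀ n, n ≤ m n)
    (h : ∀ n, cantorMeasure (A n) ≤ 2⁻¹ ^ m n) : cantorMeasure {x | ∃ᶠ n in atTop, x ∈ A n} = 0 := by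
  refine measure_setOfPred_frequently_eq_zero (p := fun n x => x ∈ A n) ?_
  have hle : ∑' n, cantorMeasure (A n) ≤ ∑' n : ℕ, (2⁻¹ : ENNReal) ^ n :=
    ENNReal.tsum_le_tsum fun n => (h n).trans
      (pow_le_pow_right_of_le_one' (ENNReal.inv_le_one.2 (by norm_num)) (hm n))
  refine ne_top_of_le_ne_top ?_ hle
  rw [ENNReal.tsum_geometric]
  simp

theorem limsupSet_eq (c : ℕ → Clopens Cantor) :
    limsupSet c = {x | ∃ᶠ n in atTop, x ∈ (c n : Set Cantor)} := by
  ext x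
  exact (Nat.frequently_atTop_iff_infinite (p := fun n => x ∈ c n)).symm

/-- The union of the first n + 1 closed null sets fits into a clopen set of measure at most 2^(-n).
A point of the m-th closed set then lies in all clopen sets from index m on, hence misses only
finitely many. -/
theorem closedNullIdeal_subset_nullModStar (hJ : IsIdealOn J) :
    closedNullIdeal ⊆ nullModStar J := by
  rintro X ⟨F, hF, hX⟩
  have key : ∀ n, ∃ C : Clopens Cantor, (∀ m ≤ n, F m ⊆ C) ∧ cantorMeasure C ≤ 2⁻¹ ^ n := by
    intro n
    have hcl : IsClosed (⋃ m ∈ Finset.range (n + 1), F m) :=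
      isClosed_biUnion_finset fun m _ => (hF m).1
    have hnull : cantorMeasure (⋃ m ∈ Finset.range (n + 1), F m) = 0 :=
      (measure_biUnion_null_iff (Finset.countable_toSet _)).2 fun m _ => (hF m).2
    obtain ⟨V, hFV, hV, hlt⟩ := Set.exists_isOpen_lt_of_lt (μ := cantorMeasure) _ (2⁻¹ ^ n)
      (by rw [hnull]; exact ENNReal.pow_pos (by simp) n)
    obtain ⟨C, hC, h1, h2⟩ := exists_clopen_of_closed_subset_open hcl hV hFV
    refine ⟨⟨C, hC⟩, fun m hm => ?_, (measure_mono h2).trans hlt.le⟩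
    exact (Set.subset_biUnion_of_mem (u := F) (Finset.mem_coe.2 (Finset.mem_range.2
      (Nat.lt_succ_of_le hm)))).trans h1
  choose C hFC hC using key
  refine ⟨C, ?_, fun x hx => ?_⟩
  · show cantorMeasure (limsupSet C) = 0
    rw [limsupSet_eq]
    exact measure_frequently_eq_zero (fun _ => le_rfl) hC
  · obtain ⟨m, hm⟩ := Set.mem_iUnion.1 (hX hx)
    refine hJ.finite_mem ((Set.finite_lt_nat m).subset fun n hn => ?_)
    by_contra h
    exact hn (hFC n m (not_lt.1 h) hm)

end Families

end NullModIdeal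

namespace NullModIdeal

/-! ### Meager sets and chopped reals -/

section Meager

/-- The `n`-th block of the partition with end points `a`. -/
def block (a : ℕ → ℕ) (n : ℕ) : Set ℕ := {i | a n ≤ i ∧ i < a (n + 1)}

theorem block_index_unique {a : ℕ → ℕ} (ha : StrictMono a) {m n i : ℕ} (hm : i ∈ block a m)
    (hn : i ∈ block a n) : m = n := by
  have h1 := ha.lt_iff_lt.1 (hm.1.trans_lt hn.2)
  have h2 := ha.lt_iff_lt.1 (hn.1.trans_lt hm.2)
  omega

theorem exists_glue {a : ℕ → ℕ} (ha : StrictMono a) (w : ℕ → Cantor) :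
    ∃ z : Cantor, ∀ n, ∀ i ∈ block a n, z i = w n i := by
  classical
  refine ⟨fun i => if h : ∃ n, i ∈ block a n then w h.choose i else false, fun n i hi => ?_⟩
  have h : ∃ n, i ∈ block a n := ⟨n, hi⟩
  simp only [dif_pos h]
  rw [block_index_unique ha h.choose_spec hi]

/-- One word placed from n on forces membership in `U` after every initial segment of length n: it
is extended once for each of these finitely many segments. -/
theorem exists_dense_extension {U : Set Cantor} (hU : IsOpen U) (hd : Dense U) (n : ℕ) :
    ∃ n' > n, ∃ w : Cantor, ∀ y : Cantor, (∀ i, n ≤ i → i < n' → y i = w i) → y ∈ U := by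
  have key : ∀ T : Finset (Finset ℕ), ∃ n' > n, ∃ w : Cantor, ∀ u ∈ T, ∀ y ∈ initSet n (ofFinset u),
      (∀ i, n ≤ i → i < n' → y i = w i) → y ∈ U := by
    intro T
    induction T using Finset.induction_on with
    | empty => exact ⟨n + 1, n.lt_succ_self, fun _ => true, by simp⟩
    | insert t T _ ih =>
      obtain ⟨m, hm, w, hw⟩ := ih
      let v : Cantor := fun i => if i < n then ofFinset t i else w i
      obtain ⟨p, hpv, hpU⟩ := hd.inter_open_nonempty _ (isClopen_initSet m v).isOpen
        ⟨v, mem_initSet_self _ _⟩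
      obtain ⟨k, hk⟩ := exists_initSet_subset hU hpU
      refine ⟨max m k, lt_max_of_lt_left hm, p, fun u hu y hy hyp => ?_⟩
      rcases Finset.mem_insert.1 hu with rfl | hu
      · refine hk fun i hi => ?_
        rcases lt_or_ge i n with h | h
        · rw [hy i h, hpv i (h.trans hm)]
          simp [v, h]
        · exact hyp i h (lt_max_of_lt_right hi)
      · refine hw u hu y hy fun i h1 h2 => ?_
        rw [hyp i h1 (lt_max_of_lt_left h2), hpv i h2]
        simp [v, h1.not_gt]
  obtain ⟨n', hn', w, hw⟩ := key (Finset.range n).powerset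
  refine ⟨n', hn', w, fun y hy => ?_⟩
  obtain ⟨u, hu, hyu⟩ := exists_mem_initSet_ofFinset n y
  exact hw u hu y hyu hy

/-- A meager set is avoided by all points that match a fixed chopped real infinitely often. -/
theorem exists_chopped_of_isMeagre {B : Set Cantor} (hB : IsMeagre B) :
    ∃ (a : ℕ → ℕ) (z : Cantor), StrictMono a ∧
      ∀ y : Cantor, (∃ᶠ n in atTop, ∀ i ∈ block a n, y i = z i) → y ∉ B := by
  obtain ⟨S, hS, hSc, hBS⟩ := isMeagre_iff_countable_union_isNowhereDense.1 hB
  obtain ⟨F, hF⟩ := (hSc.insert ∅).exists_eq_range (Set.insert_nonempty _ _)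
  have hnd : ∀ n, IsNowhereDense (F n) := by
    intro n
    have : F n ∈ insert ∅ S := hF ▸ ⟨n, rfl⟩
    rcases this with h | h
    · rw [h]
      exact isNowhereDense_empty
    · exact hS _ h
  let V : ℕ → Set Cantor := fun n => ⋂ m ∈ Finset.range (n + 1), (closure (F m))ᶜ
  have hV : ∀ n, IsOpen (V n) ∧ Dense (V n) := by
    intro n
    refine ⟨isOpen_biInter_finset fun m _ => isClosed_closure.isOpen_compl, ?_⟩
    refine dense_biInter_of_isOpen (fun m _ => isClosed_closure.isOpen_compl)
      (Finset.countable_toSet _) fun m _ => ?_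
    exact interior_eq_empty_iff_dense_compl.1 (hnd m)
  choose N hN w hw using fun n m => exists_dense_extension (hV n).1 (hV n).2 m
  let a : ℕ → ℕ := fun n => Nat.rec 0 (fun n m => N n m) n
  have ha : StrictMono a := strictMono_nat_of_lt_succ fun n => hN n (a n)
  obtain ⟨z, hz⟩ := exists_glue ha fun n => w n (a n)
  refine ⟨a, z, ha, fun y hy hyB => ?_⟩
  obtain ⟨s, hs, hys⟩ := hBS hyB
  have : s ∈ Set.range F := hF ▸ Set.mem_insert_of_mem _ hs
  obtain ⟨m, rfl⟩ := this
  obtain ⟨n, hyn, hmn⟩ := (hy.and_eventually (eventually_ge_atTop m)).exists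
  have hyV : y ∈ V n := hw n (a n) y fun i h1 h2 => by
    rw [hyn i ⟨h1, h2⟩, hz n i ⟨h1, h2⟩]
  have := Set.mem_iInter₂.1 hyV m (Finset.mem_range.2 (Nat.lt_succ_of_le hmn))
  exact this (subset_closure hys)

theorem exists_chopped (B : Set Cantor) :
    ∃ (a : ℕ → ℕ) (z : Cantor), StrictMono a ∧ (IsMeagre B →
      ∀ y : Cantor, (∃ᶠ n in atTop, ∀ i ∈ block a n, y i = z i) → y ∉ B) := by
  by_cases hB : IsMeagre B
  · obtain ⟨a, z, h1, h2⟩ := exists_chopped_of_isMeagre hB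
    exact ⟨a, z, h1, fun _ => h2⟩
  · exact ⟨id, fun _ => true, strictMono_id, fun h => absurd h hB⟩

/-- Disagreement on all blocks from m on is a closed condition with empty interior, because any
finite initial segment can be continued by x and then matches x on a later block. -/
theorem isMeagre_eventually_ne {a : ℕ → ℕ} (ha : StrictMono a) (x : Cantor) :
    IsMeagre {y : Cantor | ∀ᶠ k in atTop, ∃ i ∈ block a k, y i ≠ x i} := by
  have hsub : {y : Cantor | ∀ᶠ k in atTop, ∃ i ∈ block a k, y i ≠ x i} ⊆
      ⋃ m : ℕ, {y : Cantor | ∀ k ≥ m, ∃ i ∈ block a k, y i ≠ x i} := by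
    intro y hy
    obtain ⟨m, hm⟩ := eventually_atTop.1 hy
    exact Set.mem_iUnion.2 ⟨m, hm⟩
  refine IsMeagre.mono hsub ?_
  refine isMeagre_iUnion fun m => IsNowhereDense.isMeagre ?_
  have hcl : IsClosed {y : Cantor | ∀ k ≥ m, ∃ i ∈ block a k, y i ≠ x i} := by
    have : {y : Cantor | ∀ k ≥ m, ∃ i ∈ block a k, y i ≠ x i} =
        ⋂ k ≥ m, (agreeSet (Finset.Ico (a k) (a (k + 1))) x)ᶜ := by
      ext y
      simp [agreeSet, block, and_assoc]
    rw [this]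
    exact isClosed_biInter fun k _ => (isClopen_agreeSet _ _).isOpen.isClosed_compl
  rw [hcl.isNowhereDense_iff, Set.eq_empty_iff_forall_notMem]
  intro y hy
  obtain ⟨n, hn⟩ := exists_initSet_subset isOpen_interior hy
  let v : Cantor := fun i => if i < n then y i else x i
  have hv : v ∈ initSet n y := fun i hi => by simp [v, hi]
  obtain ⟨i, hi, hne⟩ := interior_subset (hn hv) (max m n) (le_max_left _ _)
  refine hne ?_
  have : ¬ i < n := not_lt.2 ((le_max_right m n).trans ((ha.le_apply).trans hi.1))
  simp [v, this]

end Meager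

/-! ### The closed null ideal against meager sets, splitting and reaping -/

section ClosedNull

/-- The covering relation of the closed null ideal is Tukey below the inclusion of meager sets. -/
theorem tukeyLE_closedNull_meager :
    TukeyLE (Set.univ : Set Cantor) closedNullIdeal (fun x A => x ∈ A)
      meagerIdeal meagerIdeal (fun A B => A ⊆ B) := by
  classical
  choose a z ha hz using exists_chopped
  -- The k-th block has length 2k + 1, so the probabilities of matching on it are summable.
  let q : ℕ → ℕ := fun k => k ^ 2
  have hq : StrictMono q := Nat.pow_left_strictMono two_ne_zero
  let good : Set Cantor → ℕ → ℕ → Set Cantor := fun B n k =>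
    {x | block q k ⊆ block (a B) n ∧ ∀ i ∈ block q k, x i = z B i}
  let D : Set Cantor → ℕ → Set Cantor := fun B m => {x | ∀ n ≥ m, ∃ k, x ∈ good B n k}
  have hqk : ∀ k, k ^ 2 ∈ block q k := fun k => ⟨le_rfl, hq k.lt_succ_self⟩
  have hkb : ∀ B n k x, x ∈ good B n k → k < a B (n + 1) := fun B n k x hx =>
    (Nat.le_self_pow two_ne_zero k).trans_lt (hx.1 (hqk k)).2
  refine ⟨fun x => {y | ∀ᶠ k in atTop, ∃ i ∈ block q k, y i ≠ x i}, fun B => ⋃ m, D B m,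
    fun x _ => isMeagre_eventually_ne hq x, fun B _ => ⟨D B, fun m => ⟨?_, ?_⟩, subset_rfl⟩, ?_⟩
  · have : D B m = ⋂ n ≥ m, ⋃ k ∈ Finset.range (a B (n + 1)), good B n k := by
      ext x
      simp only [D, Set.mem_ofPred_eq, Set.mem_iInter, Set.mem_iUnion, Finset.mem_range, exists_prop]
      exact forall₂_congr fun n _ => exists_congr fun k => ⟨fun h => ⟨hkb _ _ _ _ h, h⟩, And.right⟩
    rw [this]
    refine isClosed_biInter fun n _ => isClosed_biUnion_finset fun k _ => ?_
    exact isClosed_const.inter (isClosed_agree _ _)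
  · refine measure_mono_null ?_ (measure_frequently_eq_zero (m := fun k => 2 * k + 1)
      (A := fun k => agreeSet (Finset.Ico (q k) (q (k + 1))) (z B)) (fun n => by omega) fun k => ?_)
    · intro x hx
      refine frequently_atTop.2 fun N => ?_
      obtain ⟨k, hk⟩ := hx (max m (N ^ 2)) (le_max_left _ _)
      refine ⟨k, ?_, fun i hi => hk.2 i (Finset.mem_Ico.1 hi)⟩
      have h1 : N ^ 2 ≤ k ^ 2 := (le_max_right m (N ^ 2)).trans
        (((ha B).le_apply).trans (hk.1 (hqk k)).1)
      exact (Nat.pow_le_pow_iff_left two_ne_zero).1 h1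
    · rw [measure_agreeSet, Nat.card_Ico]
      have : q (k + 1) - q k = 2 * k + 1 := by
        simp only [q]
        rw [show (k + 1) ^ 2 = k ^ 2 + (2 * k + 1) by ring, Nat.add_sub_cancel_left]
      rw [this]
  · intro x _ B hB hxB
    by_contra hx
    have hfr : ∃ᶠ n in atTop, ∀ k, x ∉ good B n k := by
      refine frequently_atTop.2 fun m => ?_
      by_contra hm
      push Not at hm
      exact hx (Set.mem_iUnion.2 ⟨m, hm⟩)
    -- Fixing a parity keeps the selected blocks of `a B` from being adjacent.
    obtain ⟨r, hr⟩ : ∃ r, ∃ᶠ n in atTop, n % 2 = r ∧ ∀ k, x ∉ good B n k := by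
      have : ∃ᶠ n in atTop, (n % 2 = 0 ∧ ∀ k, x ∉ good B n k) ∨
          (n % 2 = 1 ∧ ∀ k, x ∉ good B n k) :=
        hfr.mono fun n hn => (Nat.mod_two_eq_zero_or_one n).imp (⟨·, hn⟩) (⟨·, hn⟩)
      rcases frequently_or_distrib.1 this with h | h
      exacts [⟨0, h⟩, ⟨1, h⟩]
    let A : Set ℕ := {n | n % 2 = r ∧ ∀ k, x ∉ good B n k}
    -- This point matches the chopped real infinitely often, so it avoids `B`; it can agree with x
    -- only inside selected blocks.
    let y : Cantor := fun i => if ∃ n ∈ A, i ∈ block (a B) n then z B i else !x i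
    have hyz : ∀ n ∈ A, ∀ i ∈ block (a B) n, y i = z B i := fun n hn i hi =>
      if_pos ⟨n, hn, hi⟩
    have hyx : ∀ i, y i = x i → ∃ n ∈ A, i ∈ block (a B) n := by
      intro i hi
      by_contra hne
      simp only [y, if_neg hne] at hi
      cases hxi : x i <;> simp [hxi] at hi
    refine hz B hB y (hr.mono fun n hn => hyz n hn) (hxB (Eventually.of_forall fun k => ?_))
    by_contra hk
    push Not at hk
    obtain ⟨n, hn, hkn⟩ := hyx _ (hk _ (hqk k))
    have hsub : block q k ⊆ block (a B) n := by
      intro i hi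
      refine ⟨hkn.1.trans hi.1, ?_⟩
      by_contra hlt
      -- An overrun would contain the first point of the next block, whose index has the wrong
      -- parity.
      have hmem : a B (n + 1) ∈ block q k := ⟨hkn.2.le, (not_lt.1 hlt).trans_lt hi.2⟩
      obtain ⟨n', hn', h'⟩ := hyx _ (hk _ hmem)
      have : n' = n + 1 := block_index_unique (ha B) h' ⟨le_rfl, ha B (n + 1).lt_succ_self⟩
      have h1 := hn.1
      have h2 := hn'.1
      omega
    exact hn.2 k ⟨hsub, fun i hi => by rw [← hk i hi, hyz n hn i (hsub hi)]⟩

/-- The points that do not split a given infinite set form a set in the closed null ideal. -/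
theorem notSplits_mem_closedNullIdeal {P : Set ℕ} (hP : P.Infinite) :
    {x : Cantor | ¬ Splits {i | x i = true} P} ∈ closedNullIdeal := by
  have hPn : ∀ m, (P \ Set.Iio m).Infinite := fun m => hP.sdiff (Set.finite_Iio m)
  refine ⟨fun m => {x | ∀ i ∈ P \ Set.Iio m, x i = true} ∪ {x | ∀ i ∈ P \ Set.Iio m, x i = false},
    fun m => ⟨(isClosed_agree _ fun _ => true).union (isClosed_agree _ fun _ => false),
      measure_union_null (measure_agree_infinite (hPn m) fun _ => true)
        (measure_agree_infinite (hPn m) fun _ => false)⟩, fun x hx => ?_⟩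
  have hfin : ∀ Q : Set ℕ, Q.Finite → ∃ m, Q ⊆ Set.Iio m := fun Q hQ => by
    obtain ⟨m, hm⟩ := hQ.bddAbove
    exact ⟨m + 1, fun i hi => Nat.lt_succ_of_le (hm hi)⟩
  rcases not_and_or.1 hx with h | h
  · obtain ⟨m, hm⟩ := hfin _ (Set.not_infinite.1 h)
    refine Set.mem_iUnion.2 ⟨m, Or.inr fun i hi => ?_⟩
    by_contra hne
    exact hi.2 (hm ⟨hi.1, by simpa using hne⟩)
  · obtain ⟨m, hm⟩ := hfin _ (Set.not_infinite.1 h)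
    refine Set.mem_iUnion.2 ⟨m, Or.inl fun i hi => ?_⟩
    by_contra hne
    exact hi.2 (hm ⟨hi.1, by simpa using hne⟩)

theorem covNum_closedNullIdeal_le_reapingNumber : covNum closedNullIdeal ≤ reapingNumber := by
  refine le_csInf ⟨_, {a | a.Infinite}, fun _ h => h, ?_, rfl⟩ ?_
  · rintro ⟨s, hs⟩
    rcases (Set.infinite_union (s := s) (t := sᶜ)).1 (by
      rw [Set.union_compl_self]; exact Set.infinite_univ) with h | h
    · exact (hs s h).2 (by simp)
    · exact (hs _ h).1 (by simp)
  · rintro _ ⟨R, hR, hns, rfl⟩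
    refine (dNum_le_mk (D := (fun P => {x : Cantor | ¬ Splits {i | x i = true} P}) '' R) ?_ ?_).trans
      Cardinal.mk_image_le
    · rintro _ ⟨P, hP, rfl⟩
      exact notSplits_mem_closedNullIdeal (hR P hP)
    · intro x _
      by_contra h
      push Not at h
      exact hns ⟨{i | x i = true}, fun P hP => not_not.1 (h _ ⟨P, hP, rfl⟩)⟩

theorem splittingNumber_le_nonNum_closedNullIdeal : splittingNumber ≤ nonNum closedNullIdeal := by
  refine le_csInf ⟨_, Set.univ, subset_rfl, ?_, rfl⟩ ?_
  · rintro ⟨A, ⟨F, hF, hA⟩, hun⟩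
    refine univ_notMem_nullIdeal (measure_mono_null ?_ (measure_iUnion_null fun n => (hF n).2))
    exact fun x _ => hA (hun x trivial)
  · rintro _ ⟨X, -, hX, rfl⟩
    -- Finite supports may be discarded, since a set that splits something is infinite.
    have hle : splittingNumber ≤
        Cardinal.mk ((fun x : Cantor => {i | x i = true}) '' X ∩ {s : Set ℕ | s.Infinite} :) := by
      refine csInf_le' ⟨_, fun s hs => hs.2, fun P hP => ?_, rfl⟩
      by_contra h
      refine hX ⟨_, notSplits_mem_closedNullIdeal hP, fun x hx hsp => h ⟨_, ⟨⟨x, hx, rfl⟩, ?_⟩, hsp⟩⟩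
      exact hsp.1.mono Set.inter_subset_right
    exact hle.trans ((Cardinal.mk_le_mk_of_subset Set.inter_subset_left).trans Cardinal.mk_image_le)

end ClosedNull

end NullModIdeal

namespace NullModIdeal

/-! ### Bartoszyński's localization theorem -/

section Localization

/-- The `s`-th of the independent clopen sets of measure `2 ^ (-k)`. -/
def indepSet (k s : ℕ) : Set Cantor := agreeSet (Finset.Ico (s * k) (s * k + k)) fun _ => true

theorem isClopen_indepSet (k s : ℕ) : IsClopen (indepSet k s) := isClopen_agreeSet _ _

/-- The extra condition `T` carries the induction: removing one more independent set subtracts the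
same quantity for `T` enlarged by k new coordinates, which gives the factor 1 - 2^(-k). -/
theorem measure_agreeSet_diff_indepSet (k : ℕ) (F : Finset ℕ) :
    ∀ T : Finset ℕ, (∀ s ∈ F, Disjoint T (Finset.Ico (s * k) (s * k + k))) →
      cantorMeasure (agreeSet T (fun _ => true) \ ⋃ s ∈ F, indepSet k s) =
        2⁻¹ ^ T.card * (1 - 2⁻¹ ^ k) ^ F.card := by
  induction F using Finset.induction_on with
  | empty =>
    intro T _
    simp [measure_agreeSet]
  | insert t F ht ih =>
    intro T hT
    have hTF : ∀ s ∈ F, Disjoint T (Finset.Ico (s * k) (s * k + k)) := fun s hs =>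
      hT s (Finset.mem_insert_of_mem hs)
    have hTt := hT t (Finset.mem_insert_self t F)
    let T' := T ∪ Finset.Ico (t * k) (t * k + k)
    have hT' : ∀ s ∈ F, Disjoint T' (Finset.Ico (s * k) (s * k + k)) := by
      intro s hs
      refine Finset.disjoint_union_left.2 ⟨hTF s hs, Finset.disjoint_left.2 fun i hi hi' => ?_⟩
      rw [Finset.mem_Ico] at hi hi'
      rcases lt_trichotomy s t with h | h | h
      · have := Nat.mul_le_mul_right k (Nat.succ_le_of_lt h)
        rw [Nat.succ_mul] at this
        omega
      · exact ht (h ▸ hs)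
      · have := Nat.mul_le_mul_right k (Nat.succ_le_of_lt h)
        rw [Nat.succ_mul] at this
        omega
    have heq : agreeSet T (fun _ => true) \ ⋃ s ∈ insert t F, indepSet k s =
        (agreeSet T (fun _ => true) \ ⋃ s ∈ F, indepSet k s) \
          (agreeSet T' (fun _ => true) \ ⋃ s ∈ F, indepSet k s) := by
      ext y
      simp only [Finset.set_biUnion_insert, Set.mem_sdiff, Set.mem_union, indepSet, agreeSet, T',
        Finset.mem_union, Set.mem_ofPred_eq]
      constructor
      · rintro ⟨h1, h2⟩
        push Not at h2
        exact ⟨⟨h1, h2.2⟩, fun h => by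
          obtain ⟨i, hi, hne⟩ := h2.1
          exact hne (h.1 i (Or.inr hi))⟩
      · rintro ⟨⟨h1, h2⟩, h3⟩
        refine ⟨h1, fun h => ?_⟩
        rcases h with h | h
        · exact h3 ⟨fun i hi => hi.elim (h1 i) (h i), h2⟩
        · exact h2 h
    have hms : ∀ T'' : Finset ℕ,
        MeasurableSet (agreeSet T'' (fun _ => true) \ ⋃ s ∈ F, indepSet k s) := fun T'' =>
      (isClopen_agreeSet _ _).isOpen.measurableSet.diff
        (Finset.measurableSet_biUnion _ fun s _ => (isClopen_indepSet k s).isOpen.measurableSet)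
    have hsub : agreeSet T' (fun _ => true) \ ⋃ s ∈ F, indepSet k s ⊆
        agreeSet T (fun _ => true) \ ⋃ s ∈ F, indepSet k s :=
      Set.sdiff_subset_sdiff_left fun y hy i hi => hy i (Finset.mem_union_left _ hi)
    rw [heq, measure_sdiff hsub (hms T').nullMeasurableSet (measure_ne_top _ _), ih T hTF, ih T' hT',
      Finset.card_union_of_disjoint hTt, Nat.card_Ico, Nat.add_sub_cancel_left,
      Finset.card_insert_of_notMem ht, pow_succ, pow_add, mul_right_comm, ← mul_assoc,
      ENNReal.mul_sub (fun _ _ => by finiteness), mul_one]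

theorem measure_compl_iUnion_indepSet (k : ℕ) (F : Finset ℕ) :
    cantorMeasure (⋃ s ∈ F, indepSet k s)ᶜ = (1 - 2⁻¹ ^ k) ^ F.card := by
  have := measure_agreeSet_diff_indepSet k F ∅ (by simp)
  have h2 : agreeSet ∅ (fun _ => true) = Set.univ := by
    ext
    simp [agreeSet]
  rwa [h2, ← Set.compl_eq_univ_sdiff, Finset.card_empty, pow_zero, one_mul] at this

/-- By 1 - t ≤ exp(-t) with t = 2^(-k), the exponent k·2^k brings the power below exp(-k). -/
theorem tendsto_one_sub_pow :
    Tendsto (fun k : ℕ => (1 - (2⁻¹ : ENNReal) ^ k) ^ (k * 2 ^ k)) atTop (nhds 0) := by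
  have hle : ∀ k : ℕ, (1 - (2⁻¹ : ENNReal) ^ k) ^ (k * 2 ^ k) ≤ ENNReal.ofReal (Real.exp (-k)) := by
    intro k
    have h1 : (1 - (2⁻¹ : ENNReal) ^ k) = ENNReal.ofReal (1 - 2⁻¹ ^ k) := by
      rw [ENNReal.ofReal_sub _ (by positivity), ENNReal.ofReal_one, ENNReal.ofReal_pow (by norm_num),
        ENNReal.ofReal_inv_of_pos (by norm_num), ENNReal.ofReal_ofNat]
    have h2 : (0 : ℝ) ≤ 1 - 2⁻¹ ^ k := sub_nonneg.2 (pow_le_one₀ (by norm_num) (by norm_num))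
    rw [h1, ← ENNReal.ofReal_pow h2]
    refine ENNReal.ofReal_le_ofReal ?_
    have h3 : 1 - (2⁻¹ : ℝ) ^ k ≤ Real.exp (-2⁻¹ ^ k) := Real.one_sub_le_exp_neg _
    refine (pow_le_pow_left₀ h2 h3 _).trans (le_of_eq ?_)
    rw [← Real.exp_nat_mul]
    congr 1
    push_cast
    rw [mul_assoc, mul_neg, ← mul_pow]
    norm_num
  refine tendsto_of_tendsto_of_tendsto_of_le_of_le tendsto_const_nhds ?_ (fun _ => zero_le) hle
  rw [← ENNReal.ofReal_zero]
  exact ENNReal.tendsto_ofReal (Real.tendsto_exp_neg_atTop_nhds_zero.comp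
    tendsto_natCast_atTop_atTop)

/-- Bartoszyński's theorem: every function can be sent to a null set in such a way that a null
set containing it yields a slalom localizing the function. -/
theorem exists_localization :
    ∃ (Φ : (ℕ → ℕ) → Set Cantor) (Ψ : Set Cantor → ℕ → Finset ℕ),
      (∀ x, Φ x ∈ nullIdeal) ∧ (∀ B k, (Ψ B k).card ≤ k * (k * 2 ^ k)) ∧
      ∀ x, ∀ B ∈ nullIdeal, Φ x ⊆ B → ∀ᶠ k in atTop, x k ∈ Ψ B k := by
  classical
  have hch : ∀ B : Set Cantor, ∃ K : Set Cantor, IsClosed K ∧ (B ∈ nullIdeal →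
      Disjoint K B ∧ cantorMeasure K ≠ 0) := by
    intro B
    by_cases hB : B ∈ nullIdeal
    · obtain ⟨K, h1, h2, h3⟩ := exists_isClosed_disjoint_of_null hB
      refine ⟨K, h1, fun _ => ⟨h2, fun h => ?_⟩⟩
      rw [h] at h3
      simp at h3
    · exact ⟨∅, isClosed_empty, fun h => absurd h hB⟩
  choose K hKc hK using hch
  obtain ⟨e, he⟩ := exists_surjective_nat (ℕ × Finset ℕ)
  let U : ℕ → Set Cantor := fun j => initSet (e j).1 (ofFinset (e j).2)
  -- If `K B ∩ U j` has positive measure, it cannot almost avoid k·2^k independent sets of measure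
  -- 2^(-k) once k is large; this bounds the size of `S B j k`.
  let S : Set Cantor → ℕ → ℕ → Set ℕ := fun B j k =>
    {s | cantorMeasure (K B ∩ U j ∩ indepSet k s) = 0}
  have hScard : ∀ B j, cantorMeasure (K B ∩ U j) ≠ 0 → ∀ᶠ k in atTop,
      ∀ F : Finset ℕ, (F : Set ℕ) ⊆ S B j k → F.card < k * 2 ^ k := by
    intro B j hj
    filter_upwards [tendsto_one_sub_pow.eventually_lt_const (pos_iff_ne_zero.2 hj)] with k hk F hF
    by_contra hge
    obtain ⟨F', hF', hc⟩ := Finset.exists_subset_card_eq (not_lt.1 hge)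
    refine hk.not_ge ?_
    rw [← hc, ← measure_compl_iUnion_indepSet]
    refine (measure_le_inter_add_sdiff cantorMeasure _ (⋃ s ∈ F', indepSet k s)).trans ?_
    have h0 : cantorMeasure (K B ∩ U j ∩ ⋃ s ∈ F', indepSet k s) = 0 := by
      rw [Set.inter_iUnion₂]
      exact (measure_biUnion_null_iff (Finset.countable_toSet _)).2 fun s hs => hF (hF' hs)
    rw [h0, zero_add]
    exact measure_mono fun y hy => hy.2
  let T : Set Cantor → ℕ → ℕ → Finset ℕ := fun B j k =>
    if h : ∃ F : Finset ℕ, (F : Set ℕ) = S B j k ∧ F.card ≤ k * 2 ^ k then h.choose else ∅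
  have hTcard : ∀ B j k, (T B j k).card ≤ k * 2 ^ k := by
    intro B j k
    simp only [T]
    split_ifs with h
    · exact h.choose_spec.2
    · simp
  have hTS : ∀ B j, cantorMeasure (K B ∩ U j) ≠ 0 → ∀ᶠ k in atTop,
      (T B j k : Set ℕ) = S B j k := by
    intro B j hj
    filter_upwards [hScard B j hj] with k hk
    have hfin : (S B j k).Finite := by
      by_contra hinf
      obtain ⟨F, hF, hc⟩ := Set.Infinite.exists_subset_card_eq hinf (k * 2 ^ k)
      exact (hk F hF).ne hc
    have h : ∃ F : Finset ℕ, (F : Set ℕ) = S B j k ∧ F.card ≤ k * 2 ^ k :=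
      ⟨hfin.toFinset, hfin.coe_toFinset, (hk _ hfin.coe_toFinset.le).le⟩
    simp only [T, dif_pos h]
    exact h.choose_spec.1
  -- Uniting only over j < k keeps the slalom narrow, yet every cylinder is taken into account from
  -- some k on.
  refine ⟨fun x => {y | ∃ᶠ k in atTop, y ∈ indepSet k (x k)},
    fun B k => (Finset.range k).biUnion fun j => T B j k, fun x => ?_, fun B k => ?_, ?_⟩
  · refine measure_frequently_eq_zero (m := id) (fun _ => le_rfl) fun k => ?_
    rw [indepSet, measure_agreeSet, Nat.card_Ico, Nat.add_sub_cancel_left, id]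
  · refine (Finset.card_biUnion_le_card_mul _ _ (k * 2 ^ k) fun j _ => hTcard B j k).trans ?_
    rw [Finset.card_range]
  · intro x B hB hxB
    by_contra hx
    obtain ⟨hdisj, hpos⟩ := hK B hB
    have hesc : ∀ n z, cantorMeasure (K B ∩ initSet n z) ≠ 0 → ∀ i, ∃ k ≥ i,
        cantorMeasure (K B ∩ initSet n z ∩ indepSet k (x k)) ≠ 0 := by
      intro n z hz i
      obtain ⟨u, -, hu⟩ := exists_mem_initSet_ofFinset n z
      obtain ⟨j, hj⟩ := he (n, u)
      have hUj : U j = initSet n z := by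
        simp only [U, hj]
        exact (initSet_congr hu).symm
      rw [← hUj] at hz ⊢
      obtain ⟨k, hk, hTk, hik, hjk⟩ := ((not_eventually.1 hx).and_eventually ((hTS B j hz).and
        ((eventually_ge_atTop i).and (eventually_gt_atTop j)))).exists
      refine ⟨k, hik, fun h0 => hk (Finset.mem_biUnion.2 ⟨j, Finset.mem_range.2 hjk, ?_⟩)⟩
      rw [← Finset.mem_coe, hTk]
      exact h0
    -- Each step shrinks to a cylinder that still meets `K B` in positive measure and lies in one
    -- more set `indepSet k (x k)`. The limit belongs to `K B` and to the set assigned to x,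
    -- contradicting disjointness from `B`.
    obtain ⟨y, hyK, hy⟩ := exists_branch (hKc B) (n₀ := 0) (z₀ := fun _ => true)
      (good := fun i n z => cantorMeasure (K B ∩ initSet n z) ≠ 0 ∧
        ∀ i' < i, ∃ k ≥ i', initSet n z ⊆ indepSet k (x k)) ⟨by simpa [initSet] using hpos, by simp⟩
      (by
        rintro i n z ⟨hz, hi⟩
        obtain ⟨k, hik, hk⟩ := hesc n z hz i
        let n' := max (n + 1) (x k * k + k)
        obtain ⟨w, hw, hle⟩ := exists_le_measure_inter_initSet n' (nonempty_of_measure_ne_zero hk)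
        have hsub : initSet n' w ⊆ initSet n z := fun v hv i hi => by
          rw [hv i (lt_max_of_lt_left (hi.trans n.lt_succ_self)), hw.1.2 i hi]
        refine ⟨n', lt_max_of_lt_left n.lt_succ_self, w, hw.1.2, fun h0 => ?_, fun i' hi' => ?_⟩
        · have h1 : cantorMeasure (K B ∩ initSet n z ∩ indepSet k (x k) ∩ initSet n' w) = 0 :=
            measure_mono_null (Set.inter_subset_inter_left _ fun v hv => hv.1.1) h0
          rw [h1, mul_zero] at hle
          exact hk (nonpos_iff_eq_zero.1 hle)
        · rcases Nat.lt_succ_iff_lt_or_eq.1 hi' with h | rfl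
          · obtain ⟨k', hk', hs⟩ := hi i' h
            exact ⟨k', hk', hsub.trans hs⟩
          · refine ⟨k, hik, fun v hv j hj => ?_⟩
            rw [hv j (lt_max_of_lt_right (Finset.mem_Ico.1 hj).2)]
            exact hw.2 j hj)
      (fun i n z h => nonempty_of_measure_ne_zero h.1)
    refine Set.disjoint_left.1 hdisj hyK (hxB (frequently_atTop.2 fun i => ?_))
    obtain ⟨n, z, ⟨-, hg⟩, hyz⟩ := hy (i + 1)
    obtain ⟨k, hk, hs⟩ := hg i i.lt_succ_self
    exact ⟨k, hk, hs hyz⟩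

end Localization

/-! ### Sequences of clopen sets under eventual inclusion -/

section OmegaBar

theorem measure_iUnion_ge_tendsto {c : ℕ → Clopens Cantor} (hc : c ∈ OmegaBar) :
    Tendsto (fun m => cantorMeasure (⋃ n ≥ m, (c n : Set Cantor))) atTop (nhds 0) := by
  have h0 : cantorMeasure (⋂ m, ⋃ n ≥ m, (c n : Set Cantor)) = 0 := by
    have : (⋂ m, ⋃ n ≥ m, (c n : Set Cantor)) = limsupSet c := by
      rw [limsupSet_eq]
      ext x
      simp [frequently_atTop]
    rw [this]
    exact hc
  rw [← h0]
  refine tendsto_measure_iInter_atTop (fun m => ?_) (fun m m' h => ?_) ⟨0, measure_ne_top _ _⟩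
  · exact (MeasurableSet.iUnion fun n => MeasurableSet.iUnion fun _ =>
      (c n).isClopen.isOpen.measurableSet).nullMeasurableSet
  · exact Set.biUnion_mono (fun n hn => le_trans h hn) fun _ _ => subset_rfl

/-- Sequences in `OmegaBar` ordered by eventual inclusion are Tukey below the null ideal. -/
theorem exists_omegaBar_tukey :
    ∃ (Φ : (ℕ → Clopens Cantor) → Set Cantor) (Ψ : Set Cantor → ℕ → Clopens Cantor),
      (∀ c ∈ OmegaBar, Φ c ∈ nullIdeal) ∧ (∀ B ∈ nullIdeal, Ψ B ∈ OmegaBar) ∧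
      ∀ c ∈ OmegaBar, ∀ B ∈ nullIdeal, Φ c ⊆ B → ∀ᶠ n in atTop, c n ≤ Ψ B n := by
  classical
  obtain ⟨Φ, Ψ, hΦ, hcard, hloc⟩ := exists_localization
  have : Countable (Clopens Cantor) :=
    TopologicalSpace.Clopens.countable_iff_secondCountable.2 inferInstance
  obtain ⟨dec, hdec⟩ := exists_surjective_nat (Finset (ℕ × Clopens Cantor))
  let tot : ℕ → Set Cantor := fun v => ⋃ p ∈ dec v, (p.2 : Set Cantor)
  -- The exponent 4k beats the slalom width k·(k·2^k) ≤ 2^(3k), leaving the summable bound 2^(-k).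
  have hcode : ∀ c : ℕ → Clopens Cantor, ∃ (m : ℕ → ℕ) (x : ℕ → ℕ), c ∈ OmegaBar → ∀ k, k ≤ m k ∧
      cantorMeasure (⋃ n ≥ m k, (c n : Set Cantor)) ≤ 2⁻¹ ^ (4 * k) ∧
      dec (x k) = (Finset.Ico (m k) (m (k + 1))).image fun n => (n, c n) := by
    intro c
    by_cases hc : c ∈ OmegaBar
    · have h1 : ∀ k : ℕ, ∃ m ≥ k, cantorMeasure (⋃ n ≥ m, (c n : Set Cantor)) ≤ 2⁻¹ ^ (4 * k) := by
        intro k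
        have hpos : (0 : ENNReal) < 2⁻¹ ^ (4 * k) := ENNReal.pow_pos (by simp) _
        obtain ⟨m, h1, h2⟩ := (((measure_iUnion_ge_tendsto hc).eventually_le_const hpos).and
          (eventually_ge_atTop k)).exists
        exact ⟨m, h2, h1⟩
      choose m hm hm' using h1
      choose x hx using fun k => hdec ((Finset.Ico (m k) (m (k + 1))).image fun n => (n, c n))
      exact ⟨m, x, fun _ k => ⟨hm k, hm' k, hx k⟩⟩
    · exact ⟨id, id, fun h => absurd h hc⟩
  choose m x hmx using hcode
  let V : Set Cantor → ℕ → Finset ℕ := fun B k =>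
    (Ψ B k).filter fun v => cantorMeasure (tot v) ≤ 2⁻¹ ^ (4 * k)
  -- Only k ≤ n are used, so the union is finite and clopen; nothing is lost, because m k ≥ k.
  let d : Set Cantor → ℕ → Clopens Cantor := fun B n =>
    (Finset.range (n + 1)).sup fun k => (V B k).sup fun v =>
      ((dec v).filter fun p => p.1 = n).sup fun p => p.2
  have hd : ∀ B n y, y ∈ d B n ↔ ∃ k ≤ n, ∃ v ∈ V B k, ∃ C, (n, C) ∈ dec v ∧ y ∈ C := by
    intro B n y
    have hsup : ∀ {ι : Type} (s : Finset ι) (f : ι → Clopens Cantor),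
        y ∈ s.sup f ↔ ∃ i ∈ s, y ∈ f i := by
      intro ι s f
      rw [← SetLike.mem_coe, Clopens.coe_finset_sup]
      simp
    simp only [d, hsup, Finset.mem_range, Nat.lt_succ_iff, Finset.mem_filter]
    refine exists_congr fun k => and_congr_right fun _ => exists_congr fun v =>
      and_congr_right fun _ => ⟨?_, ?_⟩
    · rintro ⟨⟨n', C⟩, ⟨h1, rfl⟩, h2⟩
      exact ⟨C, h1, h2⟩
    · rintro ⟨C, h1, h2⟩
      exact ⟨(n, C), ⟨h1, rfl⟩, h2⟩
  refine ⟨fun c => Φ (x c), d, fun c _ => hΦ _, fun B _ => ?_, fun c hc B hB hcB => ?_⟩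
  · let W : ℕ → Set Cantor := fun k => ⋃ v ∈ V B k, tot v
    refine measure_mono_null (t := {y | ∃ᶠ k in atTop, y ∈ W k}) (fun y hy => ?_)
      (measure_frequently_eq_zero (m := id) (fun _ => le_rfl) fun k => ?_)
    · by_contra hne
      obtain ⟨k₀, hk₀⟩ := eventually_atTop.1 (not_frequently.1 hne)
      refine hy ((Finset.finite_toSet ((Finset.range k₀).biUnion fun k => (V B k).biUnion fun v =>
        (dec v).image Prod.fst)).subset fun n hn => ?_)
      obtain ⟨k, -, v, hv, C, hC, hyC⟩ := (hd B n y).1 hn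
      simp only [Finset.mem_coe, Finset.mem_biUnion, Finset.mem_range, Finset.mem_image]
      refine ⟨k, ?_, v, hv, (n, C), hC, rfl⟩
      by_contra hk
      refine hk₀ k (not_lt.1 hk) (Set.mem_biUnion hv ?_)
      exact Set.mem_biUnion (show (n, C) ∈ (dec v : Set _) from hC) hyC
    · have h1 : cantorMeasure (W k) ≤ ∑ v ∈ V B k, 2⁻¹ ^ (4 * k) :=
        (measure_biUnion_finset_le _ _).trans
          (Finset.sum_le_sum fun v hv => (Finset.mem_filter.1 hv).2)
      have h2 : (V B k).card ≤ 2 ^ (3 * k) := by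
        refine (Finset.card_filter_le _ _).trans ((hcard B k).trans ?_)
        have hk := k.lt_two_pow_self.le
        calc k * (k * 2 ^ k) ≤ 2 ^ k * (2 ^ k * 2 ^ k) := by gcongr
          _ = 2 ^ (3 * k) := by ring
      refine h1.trans ?_
      rw [Finset.sum_const, nsmul_eq_mul]
      calc ((V B k).card : ENNReal) * 2⁻¹ ^ (4 * k) ≤ 2 ^ (3 * k) * 2⁻¹ ^ (4 * k) := by
            gcongr
            exact_mod_cast h2
        _ = (2 * 2⁻¹) ^ (3 * k) * 2⁻¹ ^ k := by
            rw [mul_pow, mul_assoc, ← pow_add]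
            congr 2
            ring
        _ = 2⁻¹ ^ id k := by
            rw [ENNReal.mul_inv_cancel (by norm_num) (by norm_num), one_pow, one_mul, id]
  · obtain ⟨k₀, hk₀⟩ := eventually_atTop.1 (hloc _ B hB hcB)
    filter_upwards [eventually_ge_atTop (m c k₀)] with n hn y hy
    -- The cut points need not be monotone; minimality of k still places n between the k-th and the
    -- next one.
    have hex : ∃ k, k₀ ≤ k ∧ n < m c (k + 1) := by
      refine ⟨max k₀ n, le_max_left _ _, ?_⟩
      have := (hmx c hc (max k₀ n + 1)).1
      have := le_max_right k₀ n
      omega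
    obtain ⟨hk, hnk⟩ := Nat.find_spec hex
    have hmk : m c (Nat.find hex) ≤ n := by
      rcases hk.eq_or_lt with h | h
      · rw [← h]
        exact hn
      · obtain ⟨k', hk'⟩ := Nat.exists_eq_succ_of_ne_zero (Nat.ne_zero_of_lt h)
        have hmin := Nat.find_min hex (m := k') (by omega)
        rw [hk'] at h ⊢
        by_contra hlt
        exact hmin ⟨Nat.lt_succ_iff.1 h, not_le.1 hlt⟩
    obtain ⟨h1, h2, h3⟩ := hmx c hc (Nat.find hex)
    refine (hd B n y).2 ⟨Nat.find hex, h1.trans hmk, x c (Nat.find hex), Finset.mem_filter.2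
      ⟨hk₀ _ hk, (measure_mono ?_).trans h2⟩, c n, ?_, hy⟩
    · intro w hw
      simp only [tot, h3, Set.mem_iUnion, Finset.mem_image, Finset.mem_Ico, exists_prop] at hw
      obtain ⟨_, ⟨n', hn', rfl⟩, hw⟩ := hw
      exact Set.mem_biUnion (show n' ∈ {n | n ≥ _} from hn'.1) hw
    · rw [h3]
      exact Finset.mem_image_of_mem _ (Finset.mem_Ico.2 ⟨hmk, hnk⟩)

variable {J : Set (Set ℕ)}

theorem posSet_mono (hJ : IsIdealOn J) {c d : ℕ → Clopens Cantor}
    (h : ∀ᶠ n in atTop, c n ≤ d n) : posSet J c ⊆ posSet J d := by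
  intro x hx hd
  obtain ⟨m, hm⟩ := eventually_atTop.1 h
  refine hx (hJ.mem_of_subset (fun n hn => ?_)
    (hJ.union_mem (hJ.finite_mem (Set.finite_Iio m)) hd))
  exact (lt_or_ge n m).imp id fun h => hm n h hn

theorem dualSet_mono (hJ : IsIdealOn J) {c d : ℕ → Clopens Cantor}
    (h : ∀ᶠ n in atTop, c n ≤ d n) : dualSet J c ⊆ dualSet J d := by
  intro x hx
  obtain ⟨m, hm⟩ := eventually_atTop.1 h
  refine hJ.mem_of_subset (fun n hn => ?_) (hJ.union_mem (hJ.finite_mem (Set.finite_Iio m)) hx)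
  exact (lt_or_ge n m).imp id fun h h' => hn (hm n h h')

/-- Monotonicity under eventual inclusion is all that is needed of N_J(c) and N*_J(c), so both
ideals are treated at once. -/
theorem tukeyLE_of_eventually_mono {N : (ℕ → Clopens Cantor) → Set Cantor}
    (hN : ∀ c d : ℕ → Clopens Cantor, (∀ᶠ n in atTop, c n ≤ d n) → N c ⊆ N d) :
    TukeyLE {X | ∃ c ∈ OmegaBar, X ⊆ N c} {X | ∃ c ∈ OmegaBar, X ⊆ N c} (fun A B => A ⊆ B)
      nullIdeal nullIdeal (fun A B => A ⊆ B) := by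
  obtain ⟨Φ, Ψ, hΦ, hΨ, h⟩ := exists_omegaBar_tukey
  choose! c hc hcN using fun X (hX : X ∈ {X | ∃ c ∈ OmegaBar, X ⊆ N c}) => hX
  exact ⟨fun X => Φ (c X), fun B => N (Ψ B), fun X hX => hΦ _ (hc X hX),
    fun B hB => ⟨Ψ B, hΨ B hB, subset_rfl⟩,
    fun X hX B hB hXB => (hcN X hX).trans (hN _ _ (h _ (hc X hX) B hB hXB))⟩

end OmegaBar

end NullModIdeal

namespace NullModIdeal

/-! ### Capturing functions infinitely often from null sets -/

section AntiLocalization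

/-- The values `s` for which some substantial part of `K` at level `l` almost lies in the set of
the points taking the value `true` at `l + s`. -/
def captured (K : Set Cantor) (l : ℕ) : Set ℕ :=
  {s | ∃ z, 2⁻¹ ^ 4 ^ (l + 1) ≤ cantorMeasure (K ∩ initSet l z) ∧
    cantorMeasure (K ∩ initSet l z ∩ {y | y (l + s) = false}) < 2⁻¹ ^ (2 * 4 ^ (l + 1) + 2)}

/-- With e + 1 such values, `A` would be covered by e + 1 pieces of measure below 2^(-(2e+2)) and a
cylinder of measure 2^(-(e+1)). Since e + 1 < 2^(e+1), this totals less than 2^(-e). -/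
theorem card_le_of_measure_inter_lt {A : Set Cantor} {l e : ℕ} (hA : 2⁻¹ ^ e ≤ cantorMeasure A)
    (F : Finset ℕ) (hF : ∀ s ∈ F, cantorMeasure (A ∩ {y | y (l + s) = false}) < 2⁻¹ ^ (2 * e + 2)) :
    F.card ≤ e := by
  by_contra hlt
  obtain ⟨G, hGF, hG⟩ := Finset.exists_subset_card_eq (Nat.succ_le_of_lt (not_le.1 hlt))
  let T := G.map (addLeftEmbedding l)
  have h1 : cantorMeasure A ≤ ∑ s ∈ G, 2⁻¹ ^ (2 * e + 2) + 2⁻¹ ^ (e + 1) := by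
    have hsub : A ⊆ (⋃ s ∈ G, A ∩ {y | y (l + s) = false}) ∪ agreeSet T fun _ => true := by
      intro y hy
      by_cases h : ∃ s ∈ G, y (l + s) = false
      · obtain ⟨s, hs, hys⟩ := h
        exact Or.inl (Set.mem_biUnion (Finset.mem_coe.2 hs) ⟨hy, hys⟩)
      · push Not at h
        refine Or.inr fun i hi => ?_
        obtain ⟨s, hs, rfl⟩ := Finset.mem_map.1 hi
        simpa using h s hs
    refine (measure_mono hsub).trans ((measure_union_le _ _).trans (add_le_add ?_ ?_))
    · exact (measure_biUnion_finset_le _ _).trans (Finset.sum_le_sum fun s hs => (hF s (hGF hs)).le)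
    · rw [measure_agreeSet, Finset.card_map, hG]
  have h2 : (2⁻¹ : ENNReal) ^ e = 2⁻¹ ^ (e + 1) + 2⁻¹ ^ (e + 1) := by
    rw [pow_succ, ← mul_add, ENNReal.inv_two_add_inv_two, mul_one]
  have hfin : ∀ n : ℕ, (2⁻¹ : ENNReal) ^ n ≠ ⊤ := fun n => by finiteness
  have h3 : (2⁻¹ : ENNReal) ^ (e + 1) ≤ (e + 1 : ℕ) * 2⁻¹ ^ (2 * e + 2) := by
    have := hA.trans h1
    rw [h2, Finset.sum_const, nsmul_eq_mul, hG] at this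
    exact (ENNReal.add_le_add_iff_right (hfin _)).1 this
  have h4 : ((e + 1 : ℕ) : ENNReal) * 2⁻¹ ^ (2 * e + 2) < 2 ^ (e + 1) * 2⁻¹ ^ (2 * e + 2) := by
    refine ENNReal.mul_lt_mul_left (ENNReal.pow_pos (by simp) _).ne' (hfin _) ?_
    exact_mod_cast (e + 1).lt_two_pow_self
  refine (h3.trans_lt h4).ne ?_
  rw [show 2 * e + 2 = (e + 1) + (e + 1) by ring, pow_add _ (e + 1) (e + 1), ← mul_assoc, ← mul_pow,
    ENNReal.mul_inv_cancel (by norm_num) (by norm_num), one_pow, one_mul]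

/-- Each of the 2^l cylinders of level l accounts for at most 4^(l+1) values. -/
theorem card_le_of_subset_captured {K : Set Cantor} {l : ℕ} {F : Finset ℕ}
    (hF : (F : Set ℕ) ⊆ captured K l) : F.card ≤ 2 ^ l * 4 ^ (l + 1) := by
  classical
  let P : Finset ℕ → ℕ → Prop := fun u s =>
    2⁻¹ ^ 4 ^ (l + 1) ≤ cantorMeasure (K ∩ initSet l (ofFinset u)) ∧
    cantorMeasure (K ∩ initSet l (ofFinset u) ∩ {y | y (l + s) = false}) <
      2⁻¹ ^ (2 * 4 ^ (l + 1) + 2)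
  have hsub : F ⊆ (Finset.range l).powerset.biUnion fun u => F.filter (P u) := by
    intro s hs
    obtain ⟨z, hz⟩ := hF hs
    obtain ⟨u, hu, hzu⟩ := exists_mem_initSet_ofFinset l z
    rw [initSet_congr hzu] at hz
    exact Finset.mem_biUnion.2 ⟨u, hu, Finset.mem_filter.2 ⟨hs, hz⟩⟩
  refine (Finset.card_le_card hsub).trans
    ((Finset.card_biUnion_le_card_mul _ _ (4 ^ (l + 1)) fun u _ => ?_).trans_eq ?_)
  · rcases (F.filter (P u)).eq_empty_or_nonempty with h | ⟨s, hs⟩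
    · simp [h]
    · exact card_le_of_measure_inter_lt (l := l) (Finset.mem_filter.1 hs).2.1 _
        fun s hs => (Finset.mem_filter.1 hs).2.2
  · rw [Finset.card_powerset, Finset.card_range]

theorem exists_enum {S : Set ℕ} {h : ℕ} (hS : ∀ F : Finset ℕ, (F : Set ℕ) ⊆ S → F.card ≤ h) :
    ∃ g : ℕ → ℕ, ∀ s ∈ S, ∃ i < h, s = g i := by
  have hfin : S.Finite := by
    by_contra hinf
    obtain ⟨F, hF, hc⟩ := Set.Infinite.exists_subset_card_eq hinf (h + 1)
    have := hS F hF
    omega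
  let L := hfin.toFinset.toList
  refine ⟨fun i => L.getD i 0, fun s hs => ?_⟩
  have hsL : s ∈ L := Finset.mem_toList.2 (hfin.mem_toFinset.2 hs)
  obtain ⟨i, hi, his⟩ := List.getElem_of_mem hsL
  refine ⟨i, hi.trans_le ?_, ?_⟩
  · rw [Finset.length_toList]
    exact hS _ hfin.coe_toFinset.le
  · exact ((List.getD_eq_getElem L 0 hi).trans his).symm

/-- The levels visited by the closed null set attached to `x`. -/
def visit (x : ℕ → ℕ) (k : ℕ) : ℕ := Nat.rec 0 (fun _ l => l + x l + 1) k

theorem visit_succ (x : ℕ → ℕ) (k : ℕ) : visit x (k + 1) = visit x k + x (visit x k) + 1 := rfl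

theorem visit_strictMono (x : ℕ → ℕ) : StrictMono (visit x) :=
  strictMono_nat_of_lt_succ fun k => by rw [visit_succ]; omega

/-- The points that eventually vanish at the positions attached to `x`. -/
def visitSet (x : ℕ → ℕ) : Set Cantor :=
  {y | ∀ᶠ k in atTop, y (visit x k + x (visit x k)) = false}

theorem visitSet_mem_closedNullIdeal (x : ℕ → ℕ) : visitSet x ∈ closedNullIdeal := by
  have hm : StrictMono fun k => visit x k + x (visit x k) := by
    refine strictMono_nat_of_lt_succ fun k => ?_
    have := visit_succ x k
    omega
  refine ⟨fun j => {y | ∀ p ∈ (fun k => visit x k + x (visit x k)) '' Set.Ici j, y p = false},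
    fun j => ⟨isClosed_agree _ fun _ => false, measure_agree_infinite
      ((Set.Ici_infinite j).image hm.injective.injOn) fun _ => false⟩, fun y hy => ?_⟩
  obtain ⟨j, hj⟩ := eventually_atTop.1 hy
  refine Set.mem_iUnion.2 ⟨j, ?_⟩
  rintro _ ⟨k, hk, rfl⟩
  exact hj k hk

/-- If no value is captured from some level on, a branch can be built that stays in `K` and vanishes
at every prescribed position from some point on, keeping measure at least 2^(-4^(n+1)) in `K` at
each visited level n. Its limit lies in both `K` and `visitSet x`. -/
theorem frequently_mem_captured {K : Set Cantor} (hK : IsClosed K) (hpos : 2⁻¹ ≤ cantorMeasure K)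
    {x : ℕ → ℕ} (hx : Disjoint K (visitSet x)) : ∃ᶠ l in atTop, x l ∈ captured K l := by
  intro hev
  obtain ⟨m, hm⟩ := eventually_atTop.1 hev
  have hcancel : ∀ (n : ℕ) (b : ENNReal), 2⁻¹ ^ n * (2 ^ n * b) = b := fun n b => by
    rw [← mul_assoc, ← mul_pow, ENNReal.inv_mul_cancel (by norm_num) (by norm_num), one_pow, one_mul]
  have hanti : ∀ {i j : ℕ}, i ≤ j → (2⁻¹ : ENNReal) ^ j ≤ 2⁻¹ ^ i := fun h =>
    pow_le_pow_right_of_le_one' (ENNReal.inv_le_one.2 (by norm_num)) h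
  have hne : K.Nonempty := nonempty_of_measure_ne_zero fun h => by
    rw [h] at hpos
    simp at hpos
  obtain ⟨z₀, -, hz₀⟩ := exists_le_measure_inter_initSet (visit x m) hne
  obtain ⟨y, hyK, hy⟩ := exists_branch hK (n₀ := visit x m) (z₀ := z₀)
    (good := fun i n z => n = visit x (m + i) ∧ 2⁻¹ ^ 4 ^ (n + 1) ≤ cantorMeasure (K ∩ initSet n z) ∧
      ∀ i' < i, z (visit x (m + i') + x (visit x (m + i'))) = false)
    (by
      refine ⟨rfl, ?_, by simp⟩
      rw [← hcancel (visit x m) (cantorMeasure _)]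
      refine le_trans ?_ (mul_le_mul' le_rfl (hpos.trans hz₀))
      rw [← pow_succ]
      exact hanti (Nat.lt_pow_self (by norm_num)).le)
    (by
      rintro i n z ⟨rfl, hz, hi⟩
      set l := visit x (m + i) with hl
      have hml : m ≤ l := (Nat.le_add_right m i).trans (visit_strictMono x).le_apply
      have hle : 2⁻¹ ^ (2 * 4 ^ (l + 1) + 2) ≤
          cantorMeasure (K ∩ initSet l z ∩ {y | y (l + x l) = false}) := by
        by_contra h
        exact hm l hml ⟨z, hz, not_le.1 h⟩
      obtain ⟨w, hw, hle'⟩ := exists_le_measure_inter_initSet (l + x l + 1)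
        (nonempty_of_measure_ne_zero fun h => by
          rw [h] at hle
          exact (ENNReal.pow_pos (by simp) _).not_ge hle)
      refine ⟨l + x l + 1, by omega, w, hw.1.2, visit_succ x (m + i), ?_, fun i' hi' => ?_⟩
      · have h1 : cantorMeasure (K ∩ initSet l z ∩ {y | y (l + x l) = false} ∩
            initSet (l + x l + 1) w) ≤ cantorMeasure (K ∩ initSet (l + x l + 1) w) :=
          measure_mono fun v hv => ⟨hv.1.1.1, hv.2⟩
        refine le_trans ?_ h1
        rw [← hcancel (l + x l + 1) (cantorMeasure _)]
        refine le_trans ?_ (mul_le_mul' le_rfl (hle.trans hle'))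
        rw [← pow_add]
        -- Descending to level l' = l + x l + 1 costs a factor 2^l', and l' + 2·4^(l+1) + 2 ≤
        -- 4^(l'+1).
        refine hanti ?_
        have h2 : 4 ^ (l + 1) ≤ 4 ^ (l + x l + 1) := Nat.pow_le_pow_right (by norm_num) (by omega)
        have h3 : l + x l + 1 < 4 ^ (l + x l + 1) := Nat.lt_pow_self (by norm_num)
        rw [pow_succ 4 (l + x l + 1)]
        omega
      · rcases Nat.lt_succ_iff_lt_or_eq.1 hi' with h | rfl
        · rw [← hi i' h]
          refine hw.1.2 _ ?_
          have h1 := visit_succ x (m + i')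
          have h2 : visit x (m + i' + 1) ≤ l := (visit_strictMono x).monotone (by omega)
          omega
        · exact hw.2)
    (fun i n z h => nonempty_of_measure_ne_zero fun h0 => by
      have h1 := h.2.1
      rw [h0] at h1
      exact (ENNReal.pow_pos (by simp) _).not_ge h1)
  refine Set.disjoint_left.1 hx hyK (eventually_atTop.2 ⟨m, fun k hk => ?_⟩)
  obtain ⟨i, rfl⟩ := Nat.exists_eq_add_of_le hk
  obtain ⟨n, z, ⟨hn, -, hz⟩, hyz⟩ := hy (i + 1)
  rw [← hz i i.lt_succ_self]
  refine hyz _ ?_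
  have := visit_succ x (m + i)
  rw [hn, ← add_assoc]
  omega

/-- Every function can be sent to a set in the closed null ideal in such a way that a null set
containing it yields a slalom of fixed width capturing the function infinitely often. -/
theorem exists_antiLocalization :
    ∃ (h : ℕ → ℕ) (G : Set Cantor → ℕ → ℕ → ℕ), ∀ x, ∀ B ∈ nullIdeal, visitSet x ⊆ B →
      ∃ᶠ l in atTop, ∃ i < h l, x l = G B l i := by
  have hch : ∀ B : Set Cantor, ∃ K : Set Cantor, B ∈ nullIdeal →
      IsClosed K ∧ Disjoint K B ∧ 2⁻¹ ≤ cantorMeasure K := by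
    intro B
    by_cases hB : B ∈ nullIdeal
    · obtain ⟨K, hK⟩ := exists_isClosed_disjoint_of_null hB
      exact ⟨K, fun _ => hK⟩
    · exact ⟨∅, fun h => absurd h hB⟩
  choose K hK using hch
  choose g hg using fun B l => exists_enum fun F hF => card_le_of_subset_captured (K := K B) (l := l) hF
  refine ⟨fun l => 2 ^ l * 4 ^ (l + 1), g, fun x B hB hx => ?_⟩
  obtain ⟨h1, h2, h3⟩ := hK B hB
  exact (frequently_mem_captured h1 h3 (h2.mono_right hx)).mono fun l hl => hg B l _ hl

end AntiLocalization

/-! ### Two captures in succession and the bounds cov(M), non(M) -/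

section Sequential

/-- Hall's condition holds because for a finite index set with maximum e, the set `A e` alone has at
least e + 1 elements. -/
theorem exists_injective_choice {A : ℕ → Finset ℕ} (hA : ∀ e, e < (A e).card) :
    ∃ f : ℕ → ℕ, Function.Injective f ∧ ∀ e, f e ∈ A e := by
  refine (Finset.all_card_le_biUnion_card_iff_exists_injective A).1 fun s => ?_
  rcases s.eq_empty_or_nonempty with rfl | hs
  · simp
  · have h1 : s ⊆ Finset.range (s.max' hs + 1) := fun i hi =>
      Finset.mem_range.2 (Nat.lt_succ_of_le (s.le_max' i hi))
    have h2 := Finset.card_le_card h1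
    rw [Finset.card_range] at h2
    exact h2.trans ((Nat.succ_le_of_lt (hA _)).trans
      (Finset.card_le_card (Finset.subset_biUnion_of_mem A (s.max'_mem hs))))

/-- The partition whose blocks are long with respect to `g`. -/
def longPartition (g : ℕ → ℕ) (j : ℕ) : ℕ :=
  Nat.rec 0 (fun _ p => p + 1 + ∑ l ∈ Finset.range (p + 1), g l) j

theorem longPartition_succ (g : ℕ → ℕ) (j : ℕ) : longPartition g (j + 1) =
    longPartition g j + 1 + ∑ l ∈ Finset.range (longPartition g j + 1), g l := rfl

theorem longPartition_strictMono (g : ℕ → ℕ) : StrictMono (longPartition g) :=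
  strictMono_nat_of_lt_succ fun j => by rw [longPartition_succ]; omega

theorem le_longPartition {g : ℕ → ℕ} {l j : ℕ} (h : l ≤ longPartition g j) :
    g l ≤ longPartition g (j + 1) := by
  rw [longPartition_succ]
  exact (Finset.single_le_sum (f := g) (fun _ _ => Nat.zero_le _)
    (Finset.mem_range.2 (Nat.lt_succ_of_le h))).trans (Nat.le_add_left _ _)

/-- Let l lie in the j-th long block. Either the l-th block of a ends before that long block does
and so lies inside it, or the block of a with index a (l + 1) starts beyond its end. The latter
block ends at a (a (l + 1) + 1) ≤ g l, so it fits into long block j + 1. -/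
theorem infinite_block_subset {a g : ℕ → ℕ} (ha : StrictMono a)
    (h : ∃ᶠ l in atTop, a (a (l + 1) + 1) ≤ g l) :
    {j | ∃ k, block a k ⊆ block (longPartition g) j}.Infinite := by
  have hb := longPartition_strictMono g
  refine Set.infinite_of_forall_exists_gt fun j₀ => ?_
  obtain ⟨l, hl, hjl⟩ := frequently_atTop.1 h (longPartition g (j₀ + 1))
  have hex : ∃ j, l < longPartition g (j + 1) :=
    ⟨l, (Nat.lt_succ_self l).trans_le hb.le_apply⟩
  let j := Nat.find hex
  have hj : l < longPartition g (j + 1) := Nat.find_spec hex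
  have hj' : longPartition g j ≤ l := by
    rcases Nat.eq_zero_or_eq_succ_pred j with h0 | h0
    · rw [h0]
      exact Nat.zero_le _
    · rw [h0]
      exact not_lt.1 (Nat.find_min hex (m := j.pred) (by change _ < j; omega))
  have hj₀ : j₀ < j := by
    have := hb.lt_iff_lt.1 (hl.trans_lt hj)
    omega
  have hal : ∀ i, i ≤ a i := fun i => ha.le_apply
  by_cases hc : a (l + 1) ≤ longPartition g (j + 1)
  · exact ⟨j, ⟨l, fun i hi => ⟨hj'.trans ((hal l).trans hi.1), hi.2.trans_le hc⟩⟩, hj₀⟩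
  · refine ⟨j + 1, ⟨a (l + 1), fun i hi => ⟨?_, hi.2.trans_le (hjl.trans (le_longPartition hj.le))⟩⟩,
      hj₀.trans j.lt_succ_self⟩
    exact (not_le.1 hc).le.trans ((hal _).trans hi.1)

theorem exists_partial_code {D : Set ℕ} (hD : D.Infinite) (b : ℕ → ℕ) (z : Cantor) (n : ℕ) :
    ∃ d u : Finset ℕ, (d : Set ℕ) ⊆ D ∧ d.card = n ∧ ∀ j ∈ d, ∀ i ∈ block b j, ofFinset u i = z i := by
  obtain ⟨d, hd, hc⟩ := hD.exists_subset_card_eq n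
  refine ⟨d, (Finset.range (∑ j ∈ d, b (j + 1))).filter fun i => z i = true, hd, hc,
    fun j hj i hi => ?_⟩
  have : i < ∑ j ∈ d, b (j + 1) := hi.2.trans_le
    (Finset.single_le_sum (f := fun j => b (j + 1)) (fun _ _ => Nat.zero_le _) hj)
  simp [ofFinset, this]

/-- Every guess e with enough candidate blocks receives one of its own, so all guesses can be
followed at once without conflict. -/
theorem exists_interleaving {b : ℕ → ℕ} (hb : StrictMono b) (d u : ℕ → Finset ℕ) :
    ∃ (y : Cantor) (f : ℕ → ℕ), Function.Injective f ∧ (∀ e, e < (d e).card → f e ∈ d e) ∧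
      ∀ e, ∀ i ∈ block b (f e), y i = ofFinset (u e) i := by
  obtain ⟨f, hf, hfd⟩ := exists_injective_choice
    -- Guesses with too few blocks get a dummy set of e + 1 elements, so that Hall's theorem applies
    -- to the whole sequence.
    (A := fun e => if e < (d e).card then d e else Finset.range (e + 1)) (fun e => by
      split_ifs with h
      · exact h
      · simp)
  obtain ⟨y, hy⟩ := exists_glue hb (Function.extend f (fun e => ofFinset (u e)) fun _ _ => true)
  refine ⟨y, f, hf, fun e he => ?_, fun e i hi => ?_⟩
  · have := hfd e
    rwa [if_pos he] at this
  · rw [hy _ i hi, hf.extend_apply]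

/-- A two-step connection: from null upper bounds of sets in the closed null ideal attached to
a meager set one computes a point outside of the meager set. -/
theorem exists_two_step_connection :
    ∃ (Φ₁ : Set Cantor → Set Cantor) (Φ₂ : Set Cantor → Set Cantor → Set Cantor)
      (Ψ : Set Cantor → Set Cantor → Cantor),
      (∀ A, Φ₁ A ∈ closedNullIdeal) ∧ (∀ B A, Φ₂ B A ∈ closedNullIdeal) ∧
      ∀ A ∈ meagerIdeal, ∀ B₁ ∈ nullIdeal, ∀ B₂ ∈ nullIdeal, Φ₁ A ⊆ B₁ → Φ₂ B₁ A ⊆ B₂ →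
        Ψ B₁ B₂ ∉ A := by
  obtain ⟨h, G, hG⟩ := exists_antiLocalization
  choose a z ha hz using exists_chopped
  let g : Set Cantor → ℕ → ℕ := fun B l => ∑ i ∈ Finset.range (h l), G B l i
  let b : Set Cantor → ℕ → ℕ := fun B => longPartition (g B)
  let D : Set Cantor → Set Cantor → Set ℕ := fun B A => {j | ∃ k, block (a A) k ⊆ block (b B) j}
  -- Large enough to exceed the index `Nat.pair l i` of every guess made at level l.
  let N : ℕ → ℕ := fun l => ∑ i ∈ Finset.range (h l), (Nat.pair l i + 1)
  obtain ⟨dec, hdec⟩ := exists_surjective_nat (Finset ℕ × Finset ℕ)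
  have hcode : ∀ B A : Set Cantor, ∃ x : ℕ → ℕ, (D B A).Infinite → ∀ l,
      ((dec (x l)).1 : Set ℕ) ⊆ D B A ∧ (dec (x l)).1.card = N l ∧
      ∀ j ∈ (dec (x l)).1, ∀ i ∈ block (b B) j, ofFinset (dec (x l)).2 i = z A i := by
    intro B A
    by_cases hD : (D B A).Infinite
    · choose d u hdu using fun l => exists_partial_code hD (b B) (z A) (N l)
      choose x hx using fun l => hdec (d l, u l)
      refine ⟨x, fun _ l => ?_⟩
      rw [hx]
      exact hdu l
    · exact ⟨id, fun h => absurd h hD⟩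
  choose x hx using hcode
  choose Ψ f hf hfd hΨ using fun B₁ B₂ : Set Cantor =>
    exists_interleaving (longPartition_strictMono (g B₁))
      (fun e => (dec (G B₂ e.unpair.1 e.unpair.2)).1) (fun e => (dec (G B₂ e.unpair.1 e.unpair.2)).2)
  refine ⟨fun A => visitSet fun l => a A (a A (l + 1) + 1), fun B A => visitSet (x B A), Ψ,
    fun A => visitSet_mem_closedNullIdeal _, fun B A => visitSet_mem_closedNullIdeal _,
    fun A hA B₁ hB₁ B₂ hB₂ h₁ h₂ => hz A hA _ ?_⟩
  have hD : (D B₁ A).Infinite := infinite_block_subset (ha A) <| (hG _ B₁ hB₁ h₁).mono <| by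
    rintro l ⟨i, hi, hl⟩
    rw [hl]
    exact Finset.single_le_sum (f := fun i => G B₁ l i) (fun _ _ => Nat.zero_le _)
      (Finset.mem_range.2 hi)
  have hx' := hx B₁ A hD
  let Q : Set ℕ := {e | e.unpair.2 < h e.unpair.1 ∧ x B₁ A e.unpair.1 = G B₂ e.unpair.1 e.unpair.2}
  have hQ : Q.Infinite := by
    refine Set.infinite_of_forall_exists_gt fun M => ?_
    obtain ⟨l, hl, i, hi, hli⟩ := frequently_atTop.1 (hG _ B₂ hB₂ h₂) (M + 1)
    refine ⟨Nat.pair l i, by simp [Q, hi, hli], ?_⟩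
    have := Nat.left_le_pair l i
    omega
  refine frequently_atTop.2 fun k₀ => ?_
  -- Infinitely many guesses are correct, and injectivity sends their blocks arbitrarily far out.
  obtain ⟨_, ⟨e, he, rfl⟩, hlt⟩ := (hQ.image (hf B₁ B₂).injOn).exists_gt (a A k₀)
  obtain ⟨hD', hcard, hag⟩ := hx' e.unpair.1
  rw [he.2] at hD' hcard hag
  have hfe : f B₁ B₂ e ∈ (dec (G B₂ e.unpair.1 e.unpair.2)).1 := by
    refine hfd B₁ B₂ e ?_
    rw [hcard]
    have := Finset.single_le_sum (f := fun i => Nat.pair e.unpair.1 i + 1) (fun _ _ => Nat.zero_le _)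
      (Finset.mem_range.2 he.1)
    simp only [Nat.pair_unpair] at this
    exact this
  obtain ⟨k, hk⟩ := hD' hfe
  refine ⟨k, ?_, fun i hi => ?_⟩
  · have h1 : a A k ∈ block (b B₁) (f B₁ B₂ e) := hk ⟨le_rfl, ha A k.lt_succ_self⟩
    have h2 := (longPartition_strictMono (g B₁)).le_apply (x := f B₁ B₂ e)
    exact ((ha A).lt_iff_lt.1 (hlt.trans_le (h2.trans h1.1))).le
  · rw [hΨ B₁ B₂ e i (hk hi), hag _ hfe i (hk hi)]

theorem isMeagre_of_countable {Y : Set Cantor} (hY : Y.Countable) : IsMeagre Y := by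
  rw [← Set.biUnion_of_singleton Y]
  refine isMeagre_biUnion hY fun x _ => IsNowhereDense.isMeagre ?_
  rw [isClosed_singleton.isNowhereDense_iff, Set.eq_empty_iff_forall_notMem]
  intro y hy
  obtain ⟨n, hn⟩ := exists_initSet_subset isOpen_interior hy
  have h1 : ∀ w ∈ initSet n y, w = x := fun w hw =>
    Set.mem_singleton_iff.1 (interior_subset (hn hw))
  have h2 := h1 (fun i => if i < n then y i else !y i) fun i hi => if_pos hi
  have h3 := congrFun (h2.trans (h1 y (mem_initSet_self n y)).symm) n
  simp at h3

/-- For a meager cover smaller than the additivity, one `B₁` bounds all first sets and then one `B₂`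
all second sets; the resulting point lies in no member of the cover. -/
theorem addNum_le_covNum_meagerIdeal {I : Set (Set Cantor)} (h1 : closedNullIdeal ⊆ I)
    (h2 : I ⊆ nullIdeal) : addNum I ≤ covNum meagerIdeal := by
  obtain ⟨Φ₁, Φ₂, Ψ, hΦ₁, hΦ₂, h⟩ := exists_two_step_connection
  obtain ⟨D, hD, hcov, hc⟩ := exists_mk_eq_dNum (X := (Set.univ : Set Cantor)) (Y := meagerIdeal)
    (R := fun x A => x ∈ A) fun x _ => ⟨{x}, isMeagre_of_countable (Set.countable_singleton x), rfl⟩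
  rw [covNum, ← hc]
  by_contra hlt
  have hbdd : ∀ Φ : Set Cantor → Set Cantor, (∀ A, Φ A ∈ closedNullIdeal) →
      ∃ B ∈ I, ∀ A ∈ D, Φ A ⊆ B := by
    intro Φ hΦ
    by_contra hB
    refine hlt ((bNum_le_mk (F := Φ '' D) ?_ ?_).trans Cardinal.mk_image_le)
    · rintro _ ⟨A, -, rfl⟩
      exact h1 (hΦ A)
    · rintro ⟨B, hBI, hB'⟩
      exact hB ⟨B, hBI, fun A hA => hB' _ ⟨A, hA, rfl⟩⟩
  obtain ⟨B₁, hB₁, hs₁⟩ := hbdd Φ₁ hΦ₁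
  obtain ⟨B₂, hB₂, hs₂⟩ := hbdd (Φ₂ B₁) (hΦ₂ B₁)
  obtain ⟨A, hA, hmem⟩ := hcov (Ψ B₁ B₂) trivial
  exact h A (hD hA) B₁ (h2 hB₁) B₂ (h2 hB₂) (hs₁ A hA) (hs₂ A hA) hmem

theorem nonNum_meagerIdeal_le_cofNum {I : Set (Set Cantor)} (h1 : closedNullIdeal ⊆ I)
    (h2 : I ⊆ nullIdeal) : nonNum meagerIdeal ≤ cofNum I := by
  obtain ⟨Φ₁, Φ₂, Ψ, hΦ₁, hΦ₂, h⟩ := exists_two_step_connection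
  obtain ⟨D, hD, hcof, hc⟩ := exists_mk_eq_dNum (X := I) (Y := I)
    (R := fun A B => A ⊆ B) fun A hA => ⟨A, hA, subset_rfl⟩
  rw [cofNum, ← hc]
  let Y : Set Cantor := (fun p : Set Cantor × Set Cantor => Ψ p.1 p.2) '' D ×ˢ D
  have hY : ∀ A ∈ meagerIdeal, ∃ y ∈ Y, y ∉ A := by
    intro A hA
    obtain ⟨B₁, hB₁, hs₁⟩ := hcof _ (h1 (hΦ₁ A))
    obtain ⟨B₂, hB₂, hs₂⟩ := hcof _ (h1 (hΦ₂ B₁ A))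
    exact ⟨_, ⟨(B₁, B₂), ⟨hB₁, hB₂⟩, rfl⟩, h A hA B₁ (h2 (hD hB₁)) B₂ (h2 (hD hB₂)) hs₁ hs₂⟩
  -- A finite `D` would make `Y` finite, hence meager. Infinity is needed for `D ×ˢ D` to have the
  -- size of `D`.
  have hinf : D.Infinite := by
    intro hfin
    have hYfin : Y.Finite := (hfin.prod hfin).image _
    obtain ⟨y, hy, hy'⟩ := hY Y (isMeagre_of_countable hYfin.countable)
    exact hy' hy
  have hle : nonNum meagerIdeal ≤ Cardinal.mk Y := by
    refine bNum_le_mk (Set.subset_univ _) ?_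
    rintro ⟨A, hA, hYA⟩
    obtain ⟨y, hy, hy'⟩ := hY A hA
    exact hy' (hYA y hy)
  refine hle.trans (Cardinal.mk_image_le.trans ?_)
  have : Infinite D := hinf.to_subtype
  rw [Cardinal.mk_congr (Equiv.Set.prod D D), Cardinal.mk_prod, Cardinal.lift_id,
    Cardinal.mul_eq_self (Cardinal.aleph0_le_mk D)]

end Sequential

end NullModIdeal

/-! ### Assembly of the inequalities -/

open NullModIdeal in
theorem theoremD (J : Set (Set ℕ)) (hJ : IsIdealOn J) :
    -- coverings
    (covNum nullIdeal ≤ covNum (nullMod J) ∧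
      covNum (nullMod J) ≤ covNum (nullModStar J) ∧
      covNum (nullModStar J) ≤ covNum closedNullIdeal ∧
      covNum closedNullIdeal ≤ min (cofNum meagerIdeal) reapingNumber) ∧
    -- uniformities
    (max (addNum meagerIdeal) splittingNumber ≤ nonNum closedNullIdeal ∧
      nonNum closedNullIdeal ≤ nonNum (nullModStar J) ∧
      nonNum (nullModStar J) ≤ nonNum (nullMod J) ∧
      nonNum (nullMod J) ≤ nonNum nullIdeal) ∧
    -- additivities
    ((addNum nullIdeal ≤ addNum (nullMod J) ∧ addNum (nullMod J) ≤ covNum meagerIdeal) ∧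
      (addNum nullIdeal ≤ addNum (nullModStar J) ∧
        addNum (nullModStar J) ≤ covNum meagerIdeal)) ∧
    -- cofinalities
    ((nonNum meagerIdeal ≤ cofNum (nullMod J) ∧ cofNum (nullMod J) ≤ cofNum nullIdeal) ∧
      (nonNum meagerIdeal ≤ cofNum (nullModStar J) ∧
        cofNum (nullModStar J) ≤ cofNum nullIdeal)) := by
  have hES := closedNullIdeal_subset_nullModStar hJ
  have hSM := nullModStar_subset_nullMod hJ
  have hMN := nullMod_subset_nullIdeal hJ
  have hs := singleton_mem_closedNullIdeal
  have hu := univ_notMem_nullIdeal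
  have hM := tukeyLE_of_eventually_mono fun c d h => posSet_mono hJ h
  have hS := tukeyLE_of_eventually_mono fun c d h => dualSet_mono hJ h
  have hrefl : ∀ A ∈ nullIdeal, ∃ B ∈ nullIdeal, A ⊆ B := fun A hA => ⟨A, hA, subset_rfl⟩
  have hE : ¬ ∃ A ∈ closedNullIdeal, ∀ x ∈ (Set.univ : Set Cantor), x ∈ A := by
    rintro ⟨A, hA, h⟩
    exact hu (Set.eq_univ_of_forall (fun x => h x trivial) ▸ hMN (hSM (hES hA)))
  refine ⟨⟨covNum_anti hMN fun x => hSM (hES (hs x)), covNum_anti hSM fun x => hES (hs x),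
    covNum_anti hES hs, le_min (tukeyLE_closedNull_meager.dNum_le fun A hA => ⟨A, hA, subset_rfl⟩)
      covNum_closedNullIdeal_le_reapingNumber⟩,
    ⟨max_le (tukeyLE_closedNull_meager.bNum_le hE) splittingNumber_le_nonNum_closedNullIdeal,
      nonNum_mono hES fun h => hu (hMN (hSM h)), nonNum_mono hSM fun h => hu (hMN h),
      nonNum_mono hMN hu⟩,
    ⟨⟨hM.bNum_le (not_exists_upper_bound (fun x => hSM (hES (hs x))) fun h => hu (hMN h)),
      addNum_le_covNum_meagerIdeal (hES.trans hSM) hMN⟩,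
      hS.bNum_le (not_exists_upper_bound (fun x => hES (hs x)) fun h => hu (hMN (hSM h))),
      addNum_le_covNum_meagerIdeal hES (hSM.trans hMN)⟩,
    ⟨nonNum_meagerIdeal_le_cofNum (hES.trans hSM) hMN, hM.dNum_le hrefl⟩,
    nonNum_meagerIdeal_le_cofNum hES (hSM.trans hMN), hS.dNum_le hrefl⟩
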